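/- **Setting.** Let $q$ be prime, $d\ge 1$, $R=\mathbb Z[X]/(X^d+1)$, $R_q=\mathbb Z_q[X]/(X^d+1)$, $\kappa,\lambda\ge 0$ and $h=\kappa+\lambda+3$. Norms on $R_q$ use centred coefficients: $\|\cdot\|_1$, and $\|\cdot\|=\|\cdot\|_2$ on vectors. Let $D_s^n$ be the centred discrete Gaussian on $\mathbb Z^n$, $D_s^n(z)\propto e^{-\|z\|^2/2s^2}$, where $s>0$. Let $\mathcal C$ be a probability distribution on $R_q$ (the challenge distribution) supported on elements $c$ with $\|c\|_1\le\omega$, $\omega\in\mathbb N$. *Statement.* A statement $x$ consists of $\mathbf A\in R_q^{\kappa\times h}$, $\mathbf B\in R_q^h$ and, for each $i$ in a finite set $PT$ of participants, of keys $\mathbf{pk}_{1,i},\mathbf{pk}_{2,i}\in R_q^h$ and of a commitment $(\mathbf{com}_{0,i},\mathrm{com}_{1,i},\mathrm{com}_{2,i},\mathrm{com}_{3,i})\in R_q^{\kappa}\times R_q^3$. The BDLOP commitment to $m_i\in R_q^3$ with randomness $\mathbf r_i$ is $\mathbf{com}_{0,i}=\mathbf A\mathbf r_i$, $\mathrm{com}_{t,i}=\mathbf{pk}_{t,i}^T\mathbf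 r_i+m_{i,t}$ for $t=1,2$, and $\mathrm{com}_{3,i}=\mathbf B^T\mathbf r_i+m_{i,3}$. Put $\mathbf{com}_0=\sum_i\mathbf{com}_{0,i}$ and $\mathrm{com}_3=\sum_i\mathrm{com}_{3,i}$. A *weak opening* of $(\mathbf{com}_0,\mathrm{com}_3)$ is a triple $(\bar c,\mathbf r^*,m^*)\in R_q\times R_q^h\times R_q$ with $\bar c$ invertible, $\|\bar c\|_1\le 2\omega$, $\|\bar c\,\mathbf r^*\|\le 2s\sqrt{2hd}$, $\mathbf A\mathbf r^*=\mathbf{com}_0$ and $\mathbf B^T\mathbf r^*+m^*=\mathrm{com}_3$. The balance relation $\mathcal R_{PoB}$ consists of the pairs of an $x$ and a weak opening with $m^*=0$. *Protocol $\pi^B$.* The prover holds $\mathbf r=\sum_i\mathbf r_i\in R^h$. It draws $\mathbf y\in R^h$ with coefficient vector distributed as $D_s^{hd}$ and sends $\mathbf w=\mathbf A\mathbf y$, $u=\mathbf B^T\mathbf y$. The verifier sends $c\leftarrow\mathcal C$. The prover puts $\mathbf z=\mathbf y+c\mathbf r$ (over $R$, with $c$ lifted to centred coefficients) and, for $v=c\mathbf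 r$, sends $\mathbf z \bmod q$ with probability $\min\bigl(1,\tfrac13 e^{(-2\langle \mathbf z,v\rangle+\|v\|^2)/2s^2}\bigr)$; otherwise it aborts. The verifier accepts iff $\|\mathbf z\|\le s\sqrt{2hd}$, $\mathbf A\mathbf z=\mathbf w+c\,\mathbf{com}_0$ and $\mathbf B^T\mathbf z=u+c\,\mathrm{com}_3$. *Honest input.* The commitments of $x$ are BDLOP commitments to some $m_i\in R_q^3$ with randomness $\mathbf r_i\in R^h$ (reduced mod $q$), $\sum_i m_{i,3}=0$, and $s\ge 11\,\omega\,\|\sum_i\mathbf r_i\|$. *Cost.* Programs for the simulator and the extractor draw elements of $R_q$ with $D_s$-distributed coefficients, draw challenges, and output the values of arithmetic expressions over $R_q$ (addition, subtraction, multiplication, inversion); the extractor may also rewind a prover with a fixed random tape to the point just after its first message and send it a challenge. Each operation, each element read, sampled or received, and each query counts as one step. **Theorem.** For all $\kappa,\lambda,PT$ there are a simulator making at most $20(\kappa+1)(h+|PT|+1)$ steps and no query, and an extractor making exactly two queries and at most $20h$ steps, both given $x$ and independent of $q,d,\omega,s,\mathcal C$, such that for all $q,d,\omega,s,\mathcal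 C,x$ as above: 1. **Completeness.** On honest input the prover does not abort with probability at least $(1-2^{-100})/3$, and conditioned on not aborting the verifier accepts with probability at least $1-2^{-hd/8}-2^{-100}/3$. 2. **Honest-verifier zero-knowledge.** On honest input every (unbounded, randomized) distinguisher has advantage at most $2^{-100}/3$ between the transcript $(\mathbf w,u,c,\mathbf z)$ of the honest interaction conditioned on not aborting and the output of the simulator on $x$. 3. **Extraction from two transcripts.** Let $(\mathbf w,u,c,\mathbf z)$ and $(\mathbf w,u,c',\mathbf z')$ be accepting, with $c,c'$ in the support of $\mathcal C$ and $\bar c=c-c'$ invertible. Put $\bar{\mathbf z}=\mathbf z-\mathbf z'$, $\mathbf r^*=\bar c^{-1}\bar{\mathbf z}$ and $v^*=\mathrm{com}_3-\bar c^{-1}\mathbf B^T\bar{\mathbf z}$. Then $v^*=0$ and $(x,(\bar c,\mathbf r^*,0))\in\mathcal R_{PoB}$. Moreover, with $\beta=s\sqrt{2hd}$, and calling $\mathbf e\in R_q^h$ an $\mathrm{MSIS}_{\kappa,h,8\omega\beta}$ solution for $\mathbf A$ if $\mathbf A\mathbf e=0$ and $0<\|\mathbf e\|\le 8\omega\beta$: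 (a) for every accepting $(\mathbf w,u,c'',\mathbf z'')$ with $c''$ in the support of $\mathcal C$, either $\mathbf z''-c''\mathbf r^*=\mathbf z-c\mathbf r^*$, or $\bar c(\mathbf z''-\mathbf z)-(c''-c)\bar{\mathbf z}$ is such a solution; (b) for every weak opening $(\bar c_1,\mathbf r_1,m_1)$ of $(\mathbf{com}_0,\mathrm{com}_3)$, either $\mathbf r_1=\mathbf r^*$ and $m_1=0$, or $\bar c_1\bar{\mathbf z}-\bar c\,(\bar c_1\mathbf r_1)$ is such a solution. 4. **Knowledge soundness.** Let $\delta=\sup_{c\in\mathrm{supp}\,\mathcal C}\Pr_{c'\leftarrow\mathcal C}[c-c'\text{ is not invertible}]$. If an arbitrary prover $\mathcal P^*$ convinces the verifier on $x$ with probability $\varepsilon>\delta$, then the extractor with rewinding black-box access to $\mathcal P^*$ outputs a witness for $x$ in $\mathcal R_{PoB}$ with probability at least $(\varepsilon-\delta)^2$. 5. **Knowledge error.** Suppose that $d$ is a power of two, $l\mid d$, $\zeta\in\mathbb Z_q$ is a primitive $2l$-th root of unity, the polynomials $X^{d/l}-\zeta^{2j+1}$, $0\le j<l$, are irreducible over $\mathbb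 Z_q$, $p\in[0,1]$, and $\mathcal C$ is the distribution with independent coefficients, $0$ with probability $p$ and $\pm1$ with probability $(1-p)/2$ each, conditioned on $\|c\|_1\le\omega$, an event of probability $P_\omega>0$. Then $$\delta\le\frac{(qM)^{d/l}}{P_\omega}\cdot\frac{l}{q^{d/l}},\qquad M=\frac1q+\frac1q\sum_{j\in\mathbb Z_q^\times}\prod_{k=0}^{l-1}\Bigl|p+(1-p)\cos\frac{2\pi j\zeta^k}{q}\Bigr|,$$ so the knowledge error is $O(l/q^{d/l})$ when $(qM)^{d/l}=O(1)$ and $1/P_\omega=O(1)$. -/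

import Mathlib

open Polynomial
open scoped ENNReal NNReal

noncomputable section

namespace PoB

/-! ## The rings `ℤ[X]/(X^d+1)` and `ℤ_q[X]/(X^d+1)`, coefficients and norms -/

/-- The negacyclic ring `S[X]/(X^d+1)`. -/
abbrev NegaRing (S : Type) [CommRing S] (d : ℕ) : Type := AdjoinRoot (X ^ d + 1 : S[X])

/-- `R = ℤ[X]/(X^d+1)`. -/
abbrev RZ (d : ℕ) : Type := NegaRing ℤ d

/-- `R_q = ℤ_q[X]/(X^d+1)`. -/
abbrev Rq (q d : ℕ) : Type := NegaRing (ZMod q) d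

theorem nega_monic (S : Type) [CommRing S] (d : ℕ) [NeZero d] : (X ^ d + 1 : S[X]).Monic := by
  simpa using monic_X_pow_add_C (1 : S) (NeZero.ne d)

/-- The `i`-th coefficient of the representative of degree `< d`. -/
def coeff {S : Type} [CommRing S] {d : ℕ} [NeZero d] (x : NegaRing S d) (i : Fin d) : S :=
  (AdjoinRoot.modByMonicHom (nega_monic S d) x).coeff i

/-- The element `∑ a_i X^i`. -/
def ofCoeffs {S : Type} [CommRing S] {d : ℕ} (a : Fin d → S) : NegaRing S d :=
  AdjoinRoot.mk _ (∑ i : Fin d, monomial (i : ℕ) (a i))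

/-- Reduction modulo `q`, as a ring homomorphism `R → R_q`. -/
def red (q d : ℕ) : RZ d →+* Rq q d :=
  AdjoinRoot.map (Int.castRingHom (ZMod q)) _ _ (by simp)

/-- The lift `R_q → R` with centred coefficients (in `(-q/2, q/2]`). -/
def lift {q d : ℕ} [NeZero d] (x : Rq q d) : RZ d :=
  ofCoeffs fun i => (coeff x i).valMinAbs

/-- Inner product of the coefficient vectors of two vectors over `R`. -/
def innerZ {d m : ℕ} [NeZero d] (x y : Fin m → RZ d) : ℝ :=
  ∑ j, ∑ i, ((coeff (S := ℤ) (x j) i : ℤ) : ℝ) * ((coeff (S := ℤ) (y j) i : ℤ) : ℝ)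

/-- Euclidean norm on `R^m`. -/
def normZ {d m : ℕ} [NeZero d] (x : Fin m → RZ d) : ℝ := √(innerZ x x)

/-- `‖x‖₁` on `R_q`, computed with centred coefficients. -/
def l1 {q d : ℕ} [NeZero d] (x : Rq q d) : ℕ := ∑ i, (coeff x i).valMinAbs.natAbs

/-- `‖x‖ = ‖x‖₂` on `R_q^m`, computed with centred coefficients. -/
def l2 {q d m : ℕ} [NeZero d] (x : Fin m → Rq q d) : ℝ :=
  √(∑ j, ∑ i, ((coeff (x j) i).valMinAbs : ℝ) ^ 2)

/-! ## Probability -/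

/-- Probability of an event. -/
def prob {α : Type} (p : PMF α) (S : Set α) : ℝ := (p.toOuterMeasure S).toReal

/-- Gaussian weight `exp (-‖z‖² / (2 s²))` of an integer vector. -/
def gaussWeight {ι : Type} [Fintype ι] (s : ℝ) (z : ι → ℤ) : ℝ≥0∞ :=
  ENNReal.ofReal (Real.exp (-(∑ i, (z i : ℝ) ^ 2) / (2 * s ^ 2)))

theorem gaussWeight_tsum_ne_zero {ι : Type} [Fintype ι] (s : ℝ) :
    ∑' z : ι → ℤ, gaussWeight s z ≠ 0 := by
  intro h
  have := ENNReal.tsum_eq_zero.1 h 0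
  simp [gaussWeight] at this

theorem gauss_one_ne_top {s : ℝ} (hs : 0 < s) :
    ∑' x : ℤ, ENNReal.ofReal (Real.exp (-((x : ℝ) ^ 2) / (2 * s ^ 2))) ≠ ⊤ := by
  have hc : 0 < 1 / (2 * s ^ 2) := by positivity
  have key : Summable fun n : ℕ => Real.exp (-((n : ℝ) ^ 2) / (2 * s ^ 2)) := by
    refine Summable.of_nonneg_of_le (fun _ => (Real.exp_pos _).le) (fun n => ?_)
      (Real.summable_exp_nat_mul_iff.2 (neg_lt_zero.2 hc))
    apply Real.exp_le_exp.2
    have h1 : (n : ℝ) ≤ (n : ℝ) ^ 2 := by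
      exact_mod_cast Nat.le_self_pow two_ne_zero n
    have : -((n : ℝ) ^ 2) / (2 * s ^ 2) = (n : ℝ) ^ 2 * -(1 / (2 * s ^ 2)) := by ring
    rw [this]
    nlinarith
  have hsum : Summable fun x : ℤ => Real.exp (-((x : ℝ) ^ 2) / (2 * s ^ 2)) :=
    Summable.of_nat_of_neg (by simpa using key) (by simpa using key)
  exact hsum.tsum_ofReal_ne_top

theorem gaussWeight_fin_ne_top {s : ℝ} (hs : 0 < s) :
    ∀ n : ℕ, ∑' z : Fin n → ℤ, gaussWeight s z ≠ ⊤
  | 0 => by simp [tsum_fintype, gaussWeight]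
  | n + 1 => by
    rw [← (Fin.consEquiv fun _ : Fin (n + 1) => ℤ).tsum_eq, ENNReal.tsum_prod']
    have h : ∀ (a : ℤ) (b : Fin n → ℤ),
        gaussWeight s ((Fin.consEquiv fun _ : Fin (n + 1) => ℤ) (a, b)) =
          ENNReal.ofReal (Real.exp (-((a : ℝ) ^ 2) / (2 * s ^ 2))) * gaussWeight s b := by
      intro a b
      rw [gaussWeight, gaussWeight, ← ENNReal.ofReal_mul (Real.exp_pos _).le, ← Real.exp_add,
        Fin.sum_univ_succ]
      congr 2
      simp [Fin.consEquiv]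
      ring
    simp_rw [h, ENNReal.tsum_mul_left, ENNReal.tsum_mul_right]
    exact ENNReal.mul_ne_top (gauss_one_ne_top hs) (gaussWeight_fin_ne_top hs n)

theorem gaussWeight_tsum_ne_top {ι : Type} [Fintype ι] {s : ℝ} (hs : 0 < s) :
    ∑' z : ι → ℤ, gaussWeight s z ≠ ⊤ := by
  let e := Fintype.equivFin ι
  rw [← (Equiv.arrowCongr e.symm (Equiv.refl ℤ)).tsum_eq]
  have h : ∀ z : Fin (Fintype.card ι) → ℤ,
      gaussWeight s ((Equiv.arrowCongr e.symm (Equiv.refl ℤ)) z) = gaussWeight s z := by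
    intro z
    simp only [gaussWeight, Equiv.arrowCongr_apply, Equiv.coe_refl, Function.comp_apply, id,
      Equiv.symm_symm]
    rw [e.sum_comp fun i => ((z i : ℤ) : ℝ) ^ 2]
  simp_rw [h]
  exact gaussWeight_fin_ne_top hs _

/-- The centred discrete Gaussian `D_s` on `ℤ^ι`. -/
def discreteGaussian (ι : Type) [Fintype ι] (s : ℝ) (hs : 0 < s) : PMF (ι → ℤ) :=
  PMF.normalize (gaussWeight s) (gaussWeight_tsum_ne_zero s) (gaussWeight_tsum_ne_top hs)

/-- `m` ring elements whose `m * d` integer coefficients are drawn from `D_s^{md}`. -/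
def gaussRing (d m : ℕ) (s : ℝ) (hs : 0 < s) : PMF (Fin m → RZ d) :=
  (discreteGaussian (Fin m × Fin d) s hs).map fun a j => ofCoeffs fun i => a (j, i)

/-- The probability with which `Rej(z, v, s)` accepts, with repetition rate `M = 3`: a uniform
`u ∈ [0,1)` is drawn and `z` is accepted iff `u ≤ (1/M) exp((-2⟨z,v⟩ + ‖v‖²) / (2 s²))`. -/
def rejAcceptProb {d m : ℕ} [NeZero d] (z v : Fin m → RZ d) (s : ℝ) : ℝ :=
  min 1 (1 / 3 * Real.exp ((-2 * innerZ z v + normZ v ^ 2) / (2 * s ^ 2)))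

/-- The rejection step; `true` means accept. -/
def rej {d m : ℕ} [NeZero d] (z v : Fin m → RZ d) (s : ℝ) : PMF Bool :=
  PMF.ofFintype
    (fun b => if b then ENNReal.ofReal (rejAcceptProb z v s)
      else 1 - ENNReal.ofReal (rejAcceptProb z v s))
    (by
      have h : ENNReal.ofReal (rejAcceptProb z v s) ≤ 1 :=
        ENNReal.ofReal_le_one.2 (min_le_left _ _)
      simp [add_tsub_cancel_of_le h])

/-! ## BDLOP commitments, weak openings, Module-SIS -/

/-- A BDLOP commitment key of height `κ`, width `m`, for `n` messages. -/
structure CommitKey (q d κ m n : ℕ) where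
  A : Matrix (Fin κ) (Fin m) (Rq q d)
  b : Fin n → Fin m → Rq q d

/-- `com₀ = A r` and `com_i = ⟨b_i, r⟩ + m_i`. -/
structure Commitment (q d κ n : ℕ) where
  com0 : Fin κ → Rq q d
  com : Fin n → Rq q d

def commit {q d κ m n : ℕ} (ctk : CommitKey q d κ m n) (msg : Fin n → Rq q d)
    (r : Fin m → Rq q d) : Commitment q d κ n where
  com0 := ctk.A.mulVec r
  com := fun i => ctk.b i ⬝ᵥ r + msg i

/-- A candidate weak opening `(c̄, r*, m*)`. -/
structure Opening (q d m n : ℕ) where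
  cbar : Rq q d
  r : Fin m → Rq q d
  msg : Fin n → Rq q d

/-- Weak opening of a BDLOP commitment with Gaussian width `s` and challenge norm bound `ω`. -/
def IsWeakOpening {q d κ m n : ℕ} [NeZero d] (ctk : CommitKey q d κ m n)
    (com : Commitment q d κ n) (s : ℝ) (ω : ℕ) (o : Opening q d m n) : Prop :=
  l1 o.cbar ≤ 2 * ω ∧ IsUnit o.cbar ∧
  l2 (fun j => o.cbar * o.r j) ≤ 2 * s * √(2 * (m * d)) ∧
  commit ctk o.msg o.r = com

/-- `z` solves the Module-SIS instance `A` with norm bound `β`. -/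
def IsMSISSolution {q d κ m : ℕ} [NeZero d] (A : Matrix (Fin κ) (Fin m) (Rq q d)) (β : ℝ)
    (z : Fin m → Rq q d) : Prop :=
  A.mulVec z = 0 ∧ 0 < l2 z ∧ l2 z ≤ β

/-! ## The balance statement, its relations and the protocol -/

/-- The public input for the participants `PT` (for a fixed transaction and asset): the common key
parts `A`, `B`, the two public keys of every participant, and all commitments. -/
structure Stmt (q d κ m : ℕ) (PT : Type) where
  A : Matrix (Fin κ) (Fin m) (Rq q d)
  B : Fin m → Rq q d
  pk : PT → Fin 2 → Fin m → Rq q d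
  com : PT → Commitment q d κ 3

variable {q d κ m : ℕ} {PT : Type}

/-- The commitment key `(A, pk_{1,i}, pk_{2,i}, B)` of participant `i`. -/
def Stmt.ctk (x : Stmt q d κ m PT) (i : PT) : CommitKey q d κ m 3 where
  A := x.A
  b := ![x.pk i 0, x.pk i 1, x.B]

/-- The rows `{0,3}` of a participant's key, which do not depend on the participant. -/
def Stmt.key03 (x : Stmt q d κ m PT) : CommitKey q d κ m 1 where
  A := x.A
  b := fun _ => x.B

/-- The rows `{0,3}` of the summed commitment. -/
def Stmt.sum03 [Fintype PT] (x : Stmt q d κ m PT) : Commitment q d κ 1 where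
  com0 := ∑ i, (x.com i).com0
  com := fun _ => ∑ i, (x.com i).com 2

/-- The relation proved by the protocol: a weak opening of the rows `{0,3}` of the summed
commitment whose message is zero. -/
def BalanceRelation [NeZero d] [Fintype PT] (s : ℝ) (ω : ℕ) (x : Stmt q d κ m PT)
    (o : Opening q d m 1) : Prop :=
  IsWeakOpening x.key03 x.sum03 s ω o ∧ o.msg = 0

/-- Honestly generated input: every commitment is opened by its participant's message and
(integral) randomness, the values in the last message slot sum to zero, and the width `s`
satisfies `s ≥ 11 ω ‖∑ r_i‖`. -/
def HonestInput [NeZero d] [Fintype PT] (s : ℝ) (ω : ℕ) (x : Stmt q d κ m PT)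
    (r : PT → Fin m → RZ d) (msg : PT → Fin 3 → Rq q d) : Prop :=
  (∀ i, x.com i = commit (x.ctk i) (msg i) (fun j => red q d (r i j))) ∧
  ∑ i, msg i 2 = 0 ∧
  11 * ω * normZ (∑ i, r i) ≤ s

structure Transcript (q d κ m : ℕ) where
  w : Fin κ → Rq q d
  u : Rq q d
  c : Rq q d
  z : Fin m → Rq q d

/-- The verifier's checks. -/
def Accepts [NeZero d] [Fintype PT] (s : ℝ) (x : Stmt q d κ m PT) (t : Transcript q d κ m) :
    Prop :=
  l2 t.z ≤ s * √(2 * (m * d)) ∧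
  x.A.mulVec t.z = t.w + t.c • ∑ i, (x.com i).com0 ∧
  x.B ⬝ᵥ t.z = t.u + t.c * ∑ i, (x.com i).com 2

/-- The interaction of the honest prover, holding `r = ∑ r_i`, with the honest verifier, who draws
the challenge from `C`; the outcome `none` means that the prover aborts in the rejection step. -/
def honestRun [NeZero d] (s : ℝ) (hs : 0 < s) (C : PMF (Rq q d)) (x : Stmt q d κ m PT)
    (r : Fin m → RZ d) : PMF (Option (Transcript q d κ m)) :=
  (gaussRing d m s hs).bind fun y =>
    C.bind fun c =>
      (rej (y + lift c • r) (lift c • r) s).map fun b =>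
        if b then
          some { w := x.A.mulVec fun j => red q d (y j)
                 u := x.B ⬝ᵥ fun j => red q d (y j)
                 c := c
                 z := fun j => red q d ((y + lift c • r) j) }
        else none

/-! ## Malicious provers and a step-counting model for the simulator and the extractor -/

/-- An arbitrary prover: with its random tape `ρ` fixed, it sends a first message and answers every
challenge with a response, or aborts. -/
structure Prover (q d κ m : ℕ) where
  Tape : Type
  tape : PMF Tape
  first : Tape → (Fin κ → Rq q d) × Rq q d
  resp : Tape → Rq q d → Option (Fin m → Rq q d)

/-- The prover with tape `ρ` convinces the verifier on challenge `c`. -/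
def Prover.Convinces [NeZero d] [Fintype PT] (P : Prover q d κ m) (s : ℝ) (x : Stmt q d κ m PT)
    (ρ : P.Tape) (c : Rq q d) : Prop :=
  ∃ z, P.resp ρ c = some z ∧ Accepts s x ⟨(P.first ρ).1, (P.first ρ).2, c, z⟩

/-- The probability that the prover convinces the honest verifier. -/
def Prover.acceptProb [NeZero d] [Fintype PT] (P : Prover q d κ m) (s : ℝ) (C : PMF (Rq q d))
    (x : Stmt q d κ m PT) : ℝ :=
  prob (P.tape.bind fun ρ => C.map fun c => (ρ, c)) {a | P.Convinces s x a.1 a.2}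

/-- Arithmetic expressions over the ring, in variables `V`. -/
inductive Term (V : Type) : Type
  | var (v : V)
  | zero
  | add (a b : Term V)
  | sub (a b : Term V)
  | mul (a b : Term V)
  | inv (a : Term V)

/-- The value of an expression (`inv` of a non-unit is `0`). -/
def Term.eval {R V : Type} [CommRing R] (env : V → R) : Term V → R
  | .var v => env v
  | .zero => 0
  | .add a b => a.eval env + b.eval env
  | .sub a b => a.eval env - b.eval env
  | .mul a b => a.eval env * b.eval env
  | .inv a => Ring.inverse (a.eval env)

def Term.size {V : Type} : Term V → ℕ
  | .var _ => 1
  | .zero => 1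
  | .add a b => a.size + b.size + 1
  | .sub a b => a.size + b.size + 1
  | .mul a b => a.size + b.size + 1
  | .inv a => a.size + 1

/-- Probabilistic programs over the ring with resettable black-box access to a prover. `V` names
the ring elements available so far, `O` the outputs, and `m` is the length of a response.
* `ret` outputs the values of expressions;
* `gauss n` draws `n` ring elements with discrete Gaussian coefficients;
* `chal` draws a challenge;
* `query c` rewinds the prover to the point just after its first message, sends it the challenge
  `c`, and receives its response. -/
inductive Prog (m : ℕ) (O : Type) : Type → Type 1
  | ret {V : Type} (out : O → Term V) : Prog m O V
  | gauss {V : Type} (n : ℕ) (next : Prog m O (V ⊕ Fin n)) : Prog m O V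
  | chal {V : Type} (next : Prog m O (V ⊕ Unit)) : Prog m O V
  | query {V : Type} (c : Term V) (next : Prog m O (V ⊕ Fin m)) : Prog m O V

/-- The number of steps: ring operations, ring elements read, written or sampled, and queries. -/
def Prog.steps {m : ℕ} {O : Type} [Fintype O] : {V : Type} → Prog m O V → ℕ
  | _, .ret out => ∑ o, (out o).size
  | _, .gauss n next => n + next.steps
  | _, .chal next => 1 + next.steps
  | _, .query c next => c.size + 1 + m + next.steps

/-- The number of runs of the prover. -/
def Prog.queries {m : ℕ} {O : Type} : {V : Type} → Prog m O V → ℕ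
  | _, .ret _ => 0
  | _, .gauss _ next => next.queries
  | _, .chal next => next.queries
  | _, .query _ next => 1 + next.queries

/-- The output distribution, given the values of the inputs and the responses `oracle` of the
prover with a fixed tape. An aborting prover is received as the zero response. -/
def Prog.run {O : Type} (s : ℝ) (hs : 0 < s) (C : PMF (Rq q d))
    (oracle : Rq q d → Option (Fin m → Rq q d)) :
    {V : Type} → Prog m O V → (V → Rq q d) → PMF (O → Rq q d)
  | _, .ret out, env => PMF.pure fun o => (out o).eval env
  | _, .gauss n next, env => (gaussRing d n s hs).bind fun y =>
      next.run s hs C oracle (Sum.elim env fun j => red q d (y j))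
  | _, .chal next, env => C.bind fun c => next.run s hs C oracle (Sum.elim env fun _ => c)
  | _, .query c next, env =>
      next.run s hs C oracle (Sum.elim env ((oracle (c.eval env)).getD 0))

/-- Names for the ring elements of the public input. -/
inductive InVar (κ m : ℕ) (PT : Type) : Type
  | A (i : Fin κ) (j : Fin m)
  | B (j : Fin m)
  | pk (i : PT) (t : Fin 2) (j : Fin m)
  | com0 (i : PT) (k : Fin κ)
  | com (i : PT) (t : Fin 3)

/-- The ring elements of the public input. -/
def Stmt.env (x : Stmt q d κ m PT) : InVar κ m PT → Rq q d
  | .A i j => x.A i j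
  | .B j => x.B j
  | .pk i t j => x.pk i t j
  | .com0 i k => (x.com i).com0 k
  | .com i t => (x.com i).com t

/-- Output names for a transcript `(w, u, c, z)`. -/
abbrev TrVar (κ m : ℕ) : Type := Fin κ ⊕ (Unit ⊕ (Unit ⊕ Fin m))

def decodeTranscript (f : TrVar κ m → Rq q d) : Transcript q d κ m where
  w := fun i => f (.inl i)
  u := f (.inr (.inl ()))
  c := f (.inr (.inr (.inl ())))
  z := fun j => f (.inr (.inr (.inr j)))

/-- Output names for a witness `(c̄, r*, m*)`. -/
abbrev WitVar (m : ℕ) : Type := Unit ⊕ (Fin m ⊕ Unit)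

def decodeOpening (f : WitVar m → Rq q d) : Opening q d m 1 where
  cbar := f (.inl ())
  r := fun j => f (.inr (.inl j))
  msg := fun _ => f (.inr (.inr ()))

/-- The transcript distribution of a simulator. -/
def simulated (Sim : Prog m (TrVar κ m) (InVar κ m PT)) (s : ℝ) (hs : 0 < s) (C : PMF (Rq q d))
    (x : Stmt q d κ m PT) : PMF (Transcript q d κ m) :=
  (Sim.run s hs C (fun _ => none) x.env).map decodeTranscript

/-- The witness distribution of an extractor with black-box access to `P`; the random tape of `P`
is drawn once and then kept fixed. -/
def extracted (Ext : Prog m (WitVar m) (InVar κ m PT)) (s : ℝ) (hs : 0 < s) (C : PMF (Rq q d))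
    (x : Stmt q d κ m PT) (P : Prover q d κ m) : PMF (Opening q d m 1) :=
  P.tape.bind fun ρ => (Ext.run s hs C (P.resp ρ) x.env).map decodeOpening

/-! ## Challenge distributions -/

/-- The largest probability, over challenges `c`, that `c - c'` is not invertible for a fresh
challenge `c'`. -/
def nonInvertibility (C : PMF (Rq q d)) : ℝ :=
  ⨆ c : {c : Rq q d // c ∈ C.support}, prob C {c' | ¬ IsUnit (c.1 - c')}

/-- `0` has weight `p` and `±1` have weight `(1-p)/2` each. -/
def ternaryWeight {q : ℕ} (p : ℝ) (a : ZMod q) : ℝ :=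
  if a = 0 then p else if a = 1 ∨ a = -1 then (1 - p) / 2 else 0

/-- The probability of `c` when its coefficients are independent with the weights above, cut off
outside `‖c‖₁ ≤ ω`. -/
def ternaryMass [NeZero d] (p : ℝ) (ω : ℕ) (c : Rq q d) : ℝ≥0∞ :=
  if l1 c ≤ ω then ∏ i, ENNReal.ofReal (ternaryWeight p (coeff c i)) else 0

theorem ternaryMass_tsum_ne_top [NeZero d] [NeZero q] (p : ℝ) (ω : ℕ) :
    ∑' c : Rq q d, ternaryMass p ω c ≠ ⊤ := by
  have := (nega_monic (ZMod q) d).finite_adjoinRoot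
  have : Finite (Rq q d) := Module.finite_of_finite (ZMod q)
  have := Fintype.ofFinite (Rq q d)
  rw [tsum_fintype]
  refine ENNReal.sum_ne_top.2 fun c _ => ?_
  unfold ternaryMass
  split_ifs
  · exact ENNReal.prod_ne_top fun _ _ => ENNReal.ofReal_ne_top
  · exact ENNReal.zero_ne_top

/-- The challenge distribution with independent ternary coefficients, conditioned on
`‖c‖₁ ≤ ω` (no condition at all if `d ≤ ω`). -/
def ternaryChallenge (q d : ℕ) [NeZero d] [NeZero q] (p : ℝ) (ω : ℕ)
    (h : ∑' c : Rq q d, ternaryMass p ω c ≠ 0) : PMF (Rq q d) :=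
  PMF.normalize (ternaryMass p ω) h (ternaryMass_tsum_ne_top p ω)

/-- `M = 1/q + (1/q) ∑_{j ≠ 0} ∏_{k < l} |p + (1-p) cos(2π j ζ^k / q)|`, the bound on the
probability of any value of a coefficient of an NTT component of a challenge. -/
def maxProbBound (q l : ℕ) [NeZero q] (p : ℝ) (ζ : ZMod q) : ℝ :=
  1 / q + 1 / q * ∑ j : ZMod q, if j = 0 then 0 else
    ∏ k ∈ Finset.range l, |p + (1 - p) * Real.cos (2 * Real.pi * ((j * ζ ^ k).val : ℝ) / q)|

end PoB

end

noncomputable section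

namespace PoB

/-! ### Coefficient vectors in the negacyclic ring -/

section Coefficients

variable {S : Type} [CommRing S] {d : ℕ}

/-! The proof combines four essentially separate arguments.

Rejection sampling. Fix a challenge c, put v = c r, and let D be the Gaussian mass. With z = y + v,
a non-aborting run outputs z with mass min(D(z - v), D(z)/3) (`gaussRing_sub_mul_rejAcceptProb`),
and the verification equations recover w and u from c and z. The ideal experiment draws c and then z
from D; it is exactly what the simulator does (`expect_simulated`). Thus the honest run is bounded
above by a third of the ideal one, and the missing mass lies where D(z) > 3 D(z - v), which forces
⟨z,v⟩ < -(12/11) s². A Chernoff bound with s ≥ 11‖v‖ makes this mass at most e^(-72)/3. Completeness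
and zero-knowledge both follow by comparing expectations of test functions that vanish on aborts
(`abs_conditional_sub_ideal_le`). The Gaussian moments needed factor over coordinates, and in
dimension one they come from Poisson summation for the theta function.

Extraction. Subtracting the verification equations of two transcripts gives A z̄ = c̄ com₀ and Bᵀ z̄
= c̄ com₃, and dividing by c̄ gives the opening. Cross-multiplying two such relations cancels the
commitment and yields a short kernel vector of A; if it vanishes, the two openings agree. Lengths
are controlled by ‖c x‖ ≤ ‖c‖₁ ‖x‖, since multiplication by X is an isometry.

Knowledge soundness. The extractor tries two independent challenges on one tape. If the tape is
accepted with probability a, it succeeds with probability at least a² - δa; averaging over tapes and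
using E[a²] ≥ E[a]² gives ε(ε - δ) ≥ (ε - δ)².

Knowledge error. A non-unit vanishes modulo some X^(d/l) - ζ^(2j+1). This imposes d/l linear
equations on disjoint blocks of l independent ternary coefficients. Fourier inversion on ℤ_q bounds
each equation's probability by M, uniformly in j; a union bound over the l factors finishes. -/

theorem coeff_add [NeZero d] (x y : NegaRing S d) (i : Fin d) :
    coeff (x + y) i = coeff x i + coeff y i := by
  simp [coeff]

theorem coeff_sub [NeZero d] (x y : NegaRing S d) (i : Fin d) :
    coeff (x - y) i = coeff x i - coeff y i := by
  simp [coeff]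

theorem coeff_zero [NeZero d] (i : Fin d) : coeff (0 : NegaRing S d) i = 0 := by
  simp [coeff]

theorem sum_monomial_coeff_fin (a : Fin d → S) (i : Fin d) :
    (∑ j : Fin d, monomial (j : ℕ) (a j)).coeff i = a i := by
  simp [Polynomial.coeff_monomial, Fin.val_inj]

theorem sum_monomial_degree_lt (a : Fin d → S) :
    (∑ j : Fin d, monomial (j : ℕ) (a j)).degree < d := by
  refine (degree_lt_iff_coeff_zero _ _).2 fun k hk => ?_
  rw [finsetSum_coeff]
  refine Finset.sum_eq_zero fun j _ => ?_
  rw [Polynomial.coeff_monomial, if_neg (by omega)]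

theorem degree_X_pow_add_one [Nontrivial S] [NeZero d] : (X ^ d + 1 : S[X]).degree = d := by
  simpa using degree_X_pow_add_C (NeZero.pos d) (1 : S)

theorem coeff_ofCoeffs [NeZero d] (a : Fin d → S) (i : Fin d) : coeff (ofCoeffs a) i = a i := by
  nontriviality S
  rw [coeff, ofCoeffs, AdjoinRoot.modByMonicHom_mk,
    (modByMonic_eq_self_iff (nega_monic S d)).2, sum_monomial_coeff_fin]
  rw [degree_X_pow_add_one]
  exact sum_monomial_degree_lt a

theorem ofCoeffs_coeff [NeZero d] (x : NegaRing S d) : ofCoeffs (coeff x) = x := by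
  rcases subsingleton_or_nontrivial S with _ | _
  · have := (AdjoinRoot.mk_surjective (g := (X ^ d + 1 : S[X]))).subsingleton
    exact Subsingleton.elim _ _
  conv_rhs => rw [← AdjoinRoot.mk_leftInverse (nega_monic S d) x]
  rw [ofCoeffs]
  congr 1
  ext k
  by_cases hk : k < d
  · exact sum_monomial_coeff_fin (coeff x) ⟨k, hk⟩
  · rw [(degree_lt_iff_coeff_zero _ _).1 (sum_monomial_degree_lt _) k (not_lt.1 hk)]
    symm
    obtain ⟨p, rfl⟩ := AdjoinRoot.mk_surjective x
    rw [AdjoinRoot.modByMonicHom_mk]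
    refine (degree_lt_iff_coeff_zero _ _).1 ?_ k (not_lt.1 hk)
    have := degree_modByMonic_lt p (nega_monic S d)
    rwa [degree_X_pow_add_one] at this

theorem coeff_injective [NeZero d] {x y : NegaRing S d} (h : ∀ i, coeff x i = coeff y i) :
    x = y := by
  rw [← ofCoeffs_coeff x, ← ofCoeffs_coeff y, funext h]

/-- Ring elements as coefficient vectors. -/
def coeffEquiv (S : Type) [CommRing S] (d : ℕ) [NeZero d] : (Fin d → S) ≃ NegaRing S d where
  toFun := ofCoeffs
  invFun := coeff
  left_inv a := funext (coeff_ofCoeffs a)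
  right_inv := ofCoeffs_coeff

theorem ofCoeffs_eq_sum (a : Fin d → S) :
    ofCoeffs a = ∑ i : Fin d,
      AdjoinRoot.of (X ^ d + 1 : S[X]) (a i) * AdjoinRoot.root (X ^ d + 1) ^ (i : ℕ) := by
  rw [ofCoeffs, map_sum]
  refine Finset.sum_congr rfl fun i _ => ?_
  rw [← C_mul_X_pow_eq_monomial, map_mul, map_pow, AdjoinRoot.mk_C, AdjoinRoot.mk_X]

theorem root_pow (S : Type) [CommRing S] (d : ℕ) :
    (AdjoinRoot.root (X ^ d + 1 : S[X])) ^ d = -1 := by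
  have h := AdjoinRoot.eval₂_root (X ^ d + 1 : S[X])
  rw [eval₂_add, eval₂_X_pow, eval₂_one] at h
  exact eq_neg_of_add_eq_zero_left h

/-- Since X^(n+1) = -1, multiplication by X is a cyclic shift with a sign on the coefficient that
wraps around. This is what makes it an isometry. -/
theorem root_mul_ofCoeffs {n : ℕ} (a : Fin (n + 1) → S) :
    AdjoinRoot.root (X ^ (n + 1) + 1 : S[X]) * ofCoeffs a =
      ofCoeffs (Fin.cons (-a (Fin.last n)) (Fin.init a) : Fin (n + 1) → S) := by
  rw [ofCoeffs_eq_sum, ofCoeffs_eq_sum, Fin.sum_univ_castSucc, Fin.sum_univ_succ, mul_add,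
    Finset.mul_sum]
  refine (add_comm _ _).trans ?_
  congr 1
  · have h := root_pow S (n + 1)
    simp only [Fin.val_last, Fin.cons_zero, map_neg, Fin.val_zero, pow_zero, mul_one]
    rw [mul_left_comm, ← pow_succ', h, mul_neg, mul_one]
  · refine Finset.sum_congr rfl fun i _ => ?_
    simp only [Fin.val_castSucc, Fin.cons_succ, Fin.init, Fin.val_succ]
    rw [mul_left_comm, ← pow_succ']

end Coefficients

/-! ### Reduction modulo q and the centred lift -/

section Reduction

variable {q d : ℕ}

theorem red_ofCoeffs (a : Fin d → ℤ) : red q d (ofCoeffs a) = ofCoeffs fun i => (a i : ZMod q) := by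
  rw [ofCoeffs_eq_sum, ofCoeffs_eq_sum, map_sum]
  refine Finset.sum_congr rfl fun i _ => ?_
  rw [map_mul, map_pow, red, AdjoinRoot.map_of, AdjoinRoot.map_root]
  rfl

theorem coeff_red [NeZero d] (x : RZ d) (i : Fin d) :
    coeff (red q d x) i = ((coeff x i : ℤ) : ZMod q) := by
  conv_lhs => rw [← ofCoeffs_coeff x, red_ofCoeffs, coeff_ofCoeffs]

theorem coeff_lift [NeZero d] (x : Rq q d) (i : Fin d) :
    coeff (lift x) i = (coeff x i).valMinAbs := by
  rw [lift, coeff_ofCoeffs]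

theorem red_lift [NeZero d] (x : Rq q d) : red q d (lift x) = x := by
  refine coeff_injective fun i => ?_
  rw [coeff_red, coeff_lift, ZMod.coe_valMinAbs]

end Reduction

/-! ### Norm inequalities over R and R_q -/

section Norms

variable {q d m : ℕ} [NeZero d]

/-- The coefficients of a vector over `R`, as a Euclidean vector. -/
def toEuclidean (x : Fin m → RZ d) : EuclideanSpace ℝ (Fin m × Fin d) :=
  WithLp.toLp 2 fun p => ((coeff (S := ℤ) (x p.1) p.2 : ℤ) : ℝ)

theorem normZ_eq_norm (x : Fin m → RZ d) : normZ x = ‖toEuclidean x‖ := by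
  rw [normZ, EuclideanSpace.norm_eq, innerZ, Fintype.sum_prod_type]
  congr 1
  refine Finset.sum_congr rfl fun j _ => Finset.sum_congr rfl fun i _ => ?_
  rw [Real.norm_eq_abs, sq_abs, sq]
  rfl

theorem normZ_nonneg (x : Fin m → RZ d) : 0 ≤ normZ x := Real.sqrt_nonneg _

theorem toEuclidean_add (x y : Fin m → RZ d) :
    toEuclidean (x + y) = toEuclidean x + toEuclidean y := by
  ext p
  simp [toEuclidean, coeff_add]

theorem toEuclidean_sub (x y : Fin m → RZ d) :
    toEuclidean (x - y) = toEuclidean x - toEuclidean y := by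
  ext p
  simp [toEuclidean, coeff_sub]

theorem toEuclidean_zero : toEuclidean (0 : Fin m → RZ d) = 0 := by
  ext p
  simp [toEuclidean, coeff_zero]

theorem toEuclidean_sum {ι : Type} (s : Finset ι) (f : ι → Fin m → RZ d) :
    toEuclidean (∑ i ∈ s, f i) = ∑ i ∈ s, toEuclidean (f i) :=
  map_sum ({ toFun := toEuclidean, map_zero' := toEuclidean_zero, map_add' := toEuclidean_add } :
    (Fin m → RZ d) →+ EuclideanSpace ℝ (Fin m × Fin d)) f s

theorem coeff_of_mul (a : ℤ) (x : RZ d) (i : Fin d) :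
    coeff (AdjoinRoot.of (X ^ d + 1 : ℤ[X]) a * x) i = a * coeff x i := by
  have : AdjoinRoot.of (X ^ d + 1 : ℤ[X]) a * x = a • x := by
    rw [← AdjoinRoot.algebraMap_eq, ← Algebra.smul_def]
  rw [this, coeff, map_smul]
  rfl

theorem normZ_of_smul (a : ℤ) (x : Fin m → RZ d) :
    normZ (AdjoinRoot.of (X ^ d + 1 : ℤ[X]) a • x) = |(a : ℝ)| * normZ x := by
  rw [normZ_eq_norm, normZ_eq_norm, ← Real.norm_eq_abs, ← norm_smul]
  congr 1
  ext p
  simp only [toEuclidean, Pi.smul_apply, smul_eq_mul, coeff_of_mul, Int.cast_mul,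
    PiLp.smul_apply]

theorem normZ_root_smul (x : Fin m → RZ d) :
    normZ (AdjoinRoot.root (X ^ d + 1 : ℤ[X]) • x) = normZ x := by
  obtain ⟨n, rfl⟩ := Nat.exists_eq_succ_of_ne_zero (NeZero.ne d)
  rw [normZ, normZ, innerZ, innerZ]
  congr 1
  refine Finset.sum_congr rfl fun j _ => ?_
  have h : (AdjoinRoot.root (X ^ (n + 1) + 1 : ℤ[X]) • x) j =
      ofCoeffs (Fin.cons (-coeff (x j) (Fin.last n)) (Fin.init (coeff (x j)))) := by
    rw [← root_mul_ofCoeffs, ofCoeffs_coeff]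
    rfl
  simp only [Nat.succ_eq_add_one, h, coeff_ofCoeffs]
  rw [Fin.sum_univ_succ, Fin.sum_univ_castSucc, add_comm]
  simp [Fin.init]

theorem normZ_root_pow_smul (k : ℕ) (x : Fin m → RZ d) :
    normZ (AdjoinRoot.root (X ^ d + 1 : ℤ[X]) ^ k • x) = normZ x := by
  induction k with
  | zero => simp
  | succ k ih => rw [pow_succ', mul_smul, normZ_root_smul, ih]

/-- Expand c in powers of X and use the triangle inequality; each power of X acts as an isometry, so
only the absolute values of the coefficients of c remain. -/
theorem normZ_smul_le (c : RZ d) (x : Fin m → RZ d) :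
    normZ (c • x) ≤ (∑ i, |((coeff c i : ℤ) : ℝ)|) * normZ x := by
  have h : c • x = ∑ i : Fin d, AdjoinRoot.of (X ^ d + 1 : ℤ[X]) (coeff c i) •
      (AdjoinRoot.root (X ^ d + 1 : ℤ[X]) ^ (i : ℕ) • x) := by
    conv_lhs => rw [← ofCoeffs_coeff c, ofCoeffs_eq_sum, Finset.sum_smul]
    simp_rw [mul_smul]
  rw [h, normZ_eq_norm, toEuclidean_sum, Finset.sum_mul]
  refine (norm_sum_le _ _).trans (Finset.sum_le_sum fun i _ => ?_)
  rw [← normZ_eq_norm, normZ_of_smul, normZ_root_pow_smul]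

theorem sum_abs_coeff_lift (c : Rq q d) : ∑ i, |((coeff (lift c) i : ℤ) : ℝ)| = l1 c := by
  rw [l1, Nat.cast_sum]
  refine Finset.sum_congr rfl fun i _ => ?_
  rw [coeff_lift, Nat.cast_natAbs, Int.cast_abs]

theorem normZ_lift_smul_le (c : Rq q d) (x : Fin m → RZ d) :
    normZ (lift c • x) ≤ l1 c * normZ x := by
  rw [← sum_abs_coeff_lift]
  exact normZ_smul_le _ _

theorem l2_eq_normZ_lift (x : Fin m → Rq q d) : l2 x = normZ fun j => lift (x j) := by
  rw [l2, normZ, innerZ]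
  simp only [coeff_lift, sq]

/-- The centred representative has the least absolute value in its residue class. Norm inequalities
over R therefore pass to R_q: lift, estimate, reduce. -/
theorem l2_red_le [NeZero q] (x : Fin m → RZ d) : l2 (fun j => red q d (x j)) ≤ normZ x := by
  rw [l2, normZ, innerZ]
  refine Real.sqrt_le_sqrt (Finset.sum_le_sum fun j _ => Finset.sum_le_sum fun i _ => ?_)
  rw [coeff_red, ← sq]
  refine sq_le_sq.2 ?_
  have h := ZMod.natAbs_min_of_le_div_two q
    (((coeff (x j) i : ℤ) : ZMod q)).valMinAbs (coeff (x j) i) (by simp)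
    (ZMod.natAbs_valMinAbs_le _)
  rw [← Int.cast_abs, ← Int.cast_abs, Int.abs_eq_natAbs, Int.abs_eq_natAbs]
  exact_mod_cast h

theorem l2_nonneg (x : Fin m → Rq q d) : 0 ≤ l2 x := Real.sqrt_nonneg _

theorem l2_sub_le [NeZero q] (x y : Fin m → Rq q d) : l2 (x - y) ≤ l2 x + l2 y := by
  rw [l2_eq_normZ_lift x, l2_eq_normZ_lift y]
  calc l2 (x - y) = l2 (fun j => red q d (((fun j => lift (x j)) - fun j => lift (y j)) j)) := by
        congr 1
        ext j
        simp [red_lift]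
    _ ≤ _ := l2_red_le _
    _ ≤ _ := by
      rw [normZ_eq_norm, normZ_eq_norm, normZ_eq_norm, toEuclidean_sub]
      exact norm_sub_le _ _

theorem l2_smul_le [NeZero q] (c : Rq q d) (x : Fin m → Rq q d) : l2 (c • x) ≤ l1 c * l2 x := by
  rw [l2_eq_normZ_lift x]
  calc l2 (c • x) = l2 (fun j => red q d ((lift c • fun j => lift (x j)) j)) := by
        congr 1
        ext j
        simp [red_lift]
    _ ≤ _ := l2_red_le _
    _ ≤ _ := normZ_lift_smul_le _ _

theorem l2_pos [NeZero q] {x : Fin m → Rq q d} (hx : x ≠ 0) : 0 < l2 x := by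
  refine (l2_nonneg x).lt_of_ne fun h => hx ?_
  have h0 := (Real.sqrt_eq_zero (Finset.sum_nonneg fun j _ => Finset.sum_nonneg fun i _ =>
    sq_nonneg _)).1 h.symm
  ext j
  refine coeff_injective fun i => ?_
  have h1 := (Finset.sum_eq_zero_iff_of_nonneg fun j _ => Finset.sum_nonneg fun i _ =>
    sq_nonneg _).1 h0 j (Finset.mem_univ _)
  have h2 := (Finset.sum_eq_zero_iff_of_nonneg fun i _ => sq_nonneg _).1 h1 i (Finset.mem_univ _)
  rw [Pi.zero_apply, coeff_zero]
  simpa using h2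

theorem l1_sub_le [NeZero q] (x y : Rq q d) : l1 (x - y) ≤ l1 x + l1 y := by
  rw [l1, l1, l1, ← Finset.sum_add_distrib]
  refine Finset.sum_le_sum fun i _ => ?_
  rw [coeff_sub, sub_eq_add_neg, ← ZMod.natAbs_valMinAbs_neg (coeff y i)]
  exact (ZMod.natAbs_valMinAbs_add_le _ _).trans (Int.natAbs_add_le _ _)

end Norms

/-! ### One-dimensional Gaussian sums via the theta functional equation -/

section Theta

open HurwitzZeta

/-- After Poisson summation a shift by a only multiplies the positive Fourier terms by phases of
modulus one, so the unshifted sum is the largest. -/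
theorem evenKernel_le_evenKernel_zero (a : ℝ) {t : ℝ} (ht : 0 < t) :
    evenKernel (a : UnitAddCircle) t ≤ evenKernel ((0 : ℝ) : UnitAddCircle) t := by
  have ht' : 0 < 1 / t := by positivity
  rw [evenKernel_functional_equation, evenKernel_functional_equation]
  refine mul_le_mul_of_nonneg_left ?_ (by positivity)
  have h0 := hasSum_int_cosKernel 0 ht'
  have ha := hasSum_int_cosKernel a ht'
  have h0' : HasSum (fun n : ℤ => Real.exp (-Real.pi * n ^ 2 * (1 / t)))
      (cosKernel ((0 : ℝ) : UnitAddCircle) (1 / t)) := by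
    rw [← Complex.hasSum_ofReal]
    simpa using h0
  refine (le_abs_self _).trans ?_
  rw [← Real.norm_eq_abs, ← Complex.norm_real, ← ha.tsum_eq, ← h0'.tsum_eq]
  refine tsum_of_norm_bounded h0'.summable.hasSum fun n => ?_
  rw [norm_mul, Complex.norm_real, Real.norm_eq_abs, Real.abs_exp]
  have : ‖Complex.exp (2 * Real.pi * Complex.I * a * n)‖ = 1 := by
    have h : 2 * Real.pi * Complex.I * a * n = ((2 * Real.pi * a * n : ℝ) : ℂ) * Complex.I := by
      push_cast
      ring
    rw [h, Complex.norm_exp_ofReal_mul_I]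
  rw [this, one_mul]

/-- On the Fourier side the sum is monotone in the width; the factor √(u/t) is the ratio of the
prefactors in the functional equation. -/
theorem evenKernel_zero_le_of_le {t u : ℝ} (ht : 0 < t) (htu : t ≤ u) :
    evenKernel ((0 : ℝ) : UnitAddCircle) t ≤
      √(u / t) * evenKernel ((0 : ℝ) : UnitAddCircle) u := by
  have hu := ht.trans_le htu
  have key : ∀ {y : ℝ}, 0 < y → HasSum (fun n : ℤ => Real.exp (-Real.pi * n ^ 2 * y))
      (cosKernel ((0 : ℝ) : UnitAddCircle) y) := by
    intro y hy
    rw [← Complex.hasSum_ofReal]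
    simpa using hasSum_int_cosKernel 0 hy
  have hle : cosKernel ((0 : ℝ) : UnitAddCircle) (1 / t) ≤
      cosKernel ((0 : ℝ) : UnitAddCircle) (1 / u) := by
    refine hasSum_le (fun n => ?_) (key (one_div_pos.2 ht)) (key (one_div_pos.2 hu))
    refine Real.exp_le_exp.2 (mul_le_mul_of_nonpos_left (one_div_le_one_div_of_le ht htu) ?_)
    have : 0 ≤ Real.pi * (n : ℝ) ^ 2 := by positivity
    linarith
  rw [evenKernel_functional_equation, evenKernel_functional_equation, ← mul_assoc,
    ← Real.sqrt_eq_rpow, ← Real.sqrt_eq_rpow]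
  have : √(u / t) * (1 / √u) = 1 / √t := by
    rw [Real.sqrt_div hu.le]
    have := Real.sqrt_pos.2 hu
    field_simp
  rw [this]
  exact mul_le_mul_of_nonneg_left hle (by positivity)

theorem tsum_ofReal_exp_eq_evenKernel (a : ℝ) {s : ℝ} (hs : 0 < s) :
    ∑' x : ℤ, ENNReal.ofReal (Real.exp (-((x + a) ^ 2) / (2 * s ^ 2))) =
      ENNReal.ofReal (evenKernel (a : UnitAddCircle) (1 / (2 * Real.pi * s ^ 2))) := by
  have h := hasSum_int_evenKernel a (t := 1 / (2 * Real.pi * s ^ 2)) (by positivity)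
  rw [← h.tsum_eq, ENNReal.ofReal_tsum_of_nonneg (fun _ => (Real.exp_pos _).le) h.summable]
  refine tsum_congr fun n => ?_
  congr 2
  have := Real.pi_ne_zero
  field_simp

/-- The one-dimensional discrete Gaussian is subgaussian. -/
theorem tsum_gauss_mul_exp_le (t : ℝ) {s : ℝ} (hs : 0 < s) :
    ∑' x : ℤ, ENNReal.ofReal (Real.exp (-((x : ℝ) ^ 2) / (2 * s ^ 2) + t * x)) ≤
      ENNReal.ofReal (Real.exp (s ^ 2 * t ^ 2 / 2)) *
        ∑' x : ℤ, ENNReal.ofReal (Real.exp (-((x : ℝ) ^ 2) / (2 * s ^ 2))) := by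
  -- Completing the square turns the exponential tilt into a shift of the Gaussian by s²t.
  have h : ∀ x : ℤ, ENNReal.ofReal (Real.exp (-((x : ℝ) ^ 2) / (2 * s ^ 2) + t * x)) =
      ENNReal.ofReal (Real.exp (s ^ 2 * t ^ 2 / 2)) *
        ENNReal.ofReal (Real.exp (-((x + (-(s ^ 2 * t))) ^ 2) / (2 * s ^ 2))) := by
    intro x
    rw [← ENNReal.ofReal_mul (Real.exp_pos _).le, ← Real.exp_add]
    congr 2
    field_simp
    ring
  simp_rw [h]
  rw [ENNReal.tsum_mul_left]
  refine mul_le_mul' le_rfl ?_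
  have h0 := tsum_ofReal_exp_eq_evenKernel 0 hs
  simp only [add_zero] at h0
  rw [h0, tsum_ofReal_exp_eq_evenKernel _ hs]
  exact ENNReal.ofReal_le_ofReal (evenKernel_le_evenKernel_zero _ (by positivity))

/-- Doubling the variance increases the total weight by at most `√2`. -/
theorem tsum_gauss_mul_exp_sq_le {s : ℝ} (hs : 0 < s) :
    ∑' x : ℤ, ENNReal.ofReal (Real.exp (-((x : ℝ) ^ 2) / (2 * s ^ 2) + x ^ 2 / (4 * s ^ 2))) ≤
      ENNReal.ofReal (√2) *
        ∑' x : ℤ, ENNReal.ofReal (Real.exp (-((x : ℝ) ^ 2) / (2 * s ^ 2))) := by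
  have h0 := tsum_ofReal_exp_eq_evenKernel 0 hs
  have h1 := tsum_ofReal_exp_eq_evenKernel 0 (s := √2 * s) (by positivity)
  simp only [add_zero] at h0 h1
  have h : ∀ x : ℤ, -((x : ℝ) ^ 2) / (2 * s ^ 2) + x ^ 2 / (4 * s ^ 2) =
      -((x : ℝ) ^ 2) / (2 * (√2 * s) ^ 2) := by
    intro x
    rw [mul_pow, Real.sq_sqrt zero_le_two]
    field_simp
    ring
  simp_rw [h]
  rw [h0, h1, ← ENNReal.ofReal_mul (Real.sqrt_nonneg _)]
  refine ENNReal.ofReal_le_ofReal ?_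
  have := evenKernel_zero_le_of_le (t := 1 / (2 * Real.pi * (√2 * s) ^ 2))
    (u := 1 / (2 * Real.pi * s ^ 2)) (by positivity) ?_
  · refine this.trans (le_of_eq ?_)
    congr 2
    rw [mul_pow, Real.sq_sqrt zero_le_two]
    have := Real.pi_ne_zero
    field_simp
  · rw [mul_pow, Real.sq_sqrt zero_le_two]
    refine one_div_le_one_div_of_le (by positivity) ?_
    have : 0 < Real.pi * s ^ 2 := by positivity
    nlinarith

end Theta

/-! ### Factorisation of Gaussian sums over coordinates -/

section Product

theorem tsum_prod_fin : ∀ {n : ℕ} (f : Fin n → ℤ → ℝ≥0∞),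
    ∑' z : Fin n → ℤ, ∏ i, f i (z i) = ∏ i, ∑' a, f i a
  | 0, f => by simp [tsum_fintype]
  | n + 1, f => by
    rw [← (Fin.consEquiv fun _ : Fin (n + 1) => ℤ).tsum_eq, ENNReal.tsum_prod',
      Fin.prod_univ_succ, ← tsum_prod_fin fun i => f i.succ]
    simp only [Fin.consEquiv, Equiv.coe_fn_mk, Fin.prod_univ_succ, Fin.cons_zero, Fin.cons_succ,
      ENNReal.tsum_mul_left, ENNReal.tsum_mul_right]

theorem tsum_prod_eq_prod_tsum {ι : Type} [Fintype ι] (f : ι → ℤ → ℝ≥0∞) :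
    ∑' z : ι → ℤ, ∏ i, f i (z i) = ∏ i, ∑' a, f i a := by
  let e := Fintype.equivFin ι
  rw [← (Equiv.arrowCongr e.symm (Equiv.refl ℤ)).tsum_eq,
    ← e.symm.prod_comp fun i => ∑' a, f i a, ← tsum_prod_fin]
  refine tsum_congr fun z => ?_
  rw [← e.symm.prod_comp]
  simp

variable {ι : Type} [Fintype ι]

theorem gaussWeight_eq_prod (s : ℝ) (z : ι → ℤ) :
    gaussWeight s z = ∏ i, ENNReal.ofReal (Real.exp (-((z i : ℝ) ^ 2) / (2 * s ^ 2))) := by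
  rw [gaussWeight, ← ENNReal.ofReal_prod_of_nonneg fun _ _ => (Real.exp_pos _).le,
    ← Real.exp_sum, ← Finset.sum_div, Finset.sum_neg_distrib]

theorem gaussWeight_mul_exp_eq_prod (s : ℝ) (f : ι → ℤ → ℝ) (z : ι → ℤ) :
    gaussWeight s z * ENNReal.ofReal (Real.exp (∑ i, f i (z i))) =
      ∏ i, ENNReal.ofReal (Real.exp (-((z i : ℝ) ^ 2) / (2 * s ^ 2) + f i (z i))) := by
  rw [gaussWeight_eq_prod, Real.exp_sum, ENNReal.ofReal_prod_of_nonneg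
    fun _ _ => (Real.exp_pos _).le, ← Finset.prod_mul_distrib]
  refine Finset.prod_congr rfl fun i _ => ?_
  rw [← ENNReal.ofReal_mul (Real.exp_pos _).le, ← Real.exp_add]

/-- Exponential moments of the discrete Gaussian from one-dimensional bounds. -/
theorem tsum_discreteGaussian_mul_exp_le {s : ℝ} (hs : 0 < s) (f : ι → ℤ → ℝ) (b : ι → ℝ)
    (hb : ∀ i, 0 ≤ b i)
    (h : ∀ i, ∑' x : ℤ, ENNReal.ofReal (Real.exp (-((x : ℝ) ^ 2) / (2 * s ^ 2) + f i x)) ≤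
      ENNReal.ofReal (b i) *
        ∑' x : ℤ, ENNReal.ofReal (Real.exp (-((x : ℝ) ^ 2) / (2 * s ^ 2)))) :
    ∑' z, discreteGaussian ι s hs z * ENNReal.ofReal (Real.exp (∑ i, f i (z i))) ≤
      ENNReal.ofReal (∏ i, b i) := by
  have h1 : ∀ z, discreteGaussian ι s hs z * ENNReal.ofReal (Real.exp (∑ i, f i (z i))) =
      (∏ i, ENNReal.ofReal (Real.exp (-((z i : ℝ) ^ 2) / (2 * s ^ 2) + f i (z i)))) *
        (∑' z : ι → ℤ, gaussWeight s z)⁻¹ := by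
    intro z
    rw [← gaussWeight_mul_exp_eq_prod, discreteGaussian, PMF.normalize_apply]
    ring
  simp_rw [h1]
  rw [ENNReal.tsum_mul_right,
    tsum_prod_eq_prod_tsum fun i x => ENNReal.ofReal (Real.exp (-((x : ℝ) ^ 2) / (2 * s ^ 2) + f i x)),
    ← div_eq_mul_inv]
  refine ENNReal.div_le_of_le_mul ?_
  simp_rw [gaussWeight_eq_prod]
  rw [tsum_prod_eq_prod_tsum fun (_ : ι) x =>
    ENNReal.ofReal (Real.exp (-((x : ℝ) ^ 2) / (2 * s ^ 2))),
    ENNReal.ofReal_prod_of_nonneg fun i _ => hb i, ← Finset.prod_mul_distrib]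
  exact Finset.prod_le_prod' fun i _ => h i

end Product

/-! ### Exponential moments and norm tail of Gaussian ring vectors -/

section GaussRing

variable {d m : ℕ} [NeZero d]

/-- Vectors over `R` as integer vectors of coefficients. -/
def ringVecEquiv (d m : ℕ) [NeZero d] : (Fin m × Fin d → ℤ) ≃ (Fin m → RZ d) where
  toFun a := fun j => ofCoeffs fun i => a (j, i)
  invFun z := fun p => coeff (z p.1) p.2
  left_inv a := funext fun p => coeff_ofCoeffs (S := ℤ) (fun i => a (p.1, i)) p.2
  right_inv z := funext fun j => ofCoeffs_coeff (S := ℤ) (z j)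

theorem gaussRing_apply {s : ℝ} (hs : 0 < s) (z : Fin m → RZ d) :
    gaussRing d m s hs z = discreteGaussian (Fin m × Fin d) s hs ((ringVecEquiv d m).symm z) := by
  have h : gaussRing d m s hs =
      (discreteGaussian (Fin m × Fin d) s hs).map (ringVecEquiv d m) := rfl
  rw [h, PMF.map_apply, tsum_eq_single ((ringVecEquiv d m).symm z)]
  · simp
  · intro a ha
    rw [if_neg]
    rintro rfl
    simp at ha

theorem innerZ_self (z : Fin m → RZ d) : innerZ z z = normZ z ^ 2 := by
  rw [normZ, Real.sq_sqrt]
  exact Finset.sum_nonneg fun j _ => Finset.sum_nonneg fun i _ => mul_self_nonneg _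

theorem sum_sq_ringVecEquiv_symm (z : Fin m → RZ d) :
    ∑ p, (((ringVecEquiv d m).symm z p : ℤ) : ℝ) ^ 2 = normZ z ^ 2 := by
  rw [← innerZ_self, Fintype.sum_prod_type, innerZ]
  simp only [sq]
  rfl

theorem gaussRing_eq {s : ℝ} (hs : 0 < s) (z : Fin m → RZ d) :
    gaussRing d m s hs z = ENNReal.ofReal (Real.exp (-(normZ z ^ 2) / (2 * s ^ 2))) *
      (∑' a : Fin m × Fin d → ℤ, gaussWeight s a)⁻¹ := by
  rw [gaussRing_apply, discreteGaussian, PMF.normalize_apply, gaussWeight,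
    sum_sq_ringVecEquiv_symm]

theorem tsum_gaussRing_mul {s : ℝ} (hs : 0 < s) (φ : (Fin m → RZ d) → ℝ≥0∞) :
    ∑' z, gaussRing d m s hs z * φ z =
      ∑' a, discreteGaussian (Fin m × Fin d) s hs a * φ (ringVecEquiv d m a) := by
  rw [← (ringVecEquiv d m).tsum_eq]
  refine tsum_congr fun a => ?_
  rw [gaussRing_apply, Equiv.symm_apply_apply]

theorem tsum_gaussRing_mul_exp_inner_le {s : ℝ} (hs : 0 < s) (t : ℝ) (v : Fin m → RZ d) :
    ∑' z, gaussRing d m s hs z * ENNReal.ofReal (Real.exp (t * innerZ z v)) ≤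
      ENNReal.ofReal (Real.exp (s ^ 2 * t ^ 2 * normZ v ^ 2 / 2)) := by
  rw [tsum_gaussRing_mul]
  have h := tsum_discreteGaussian_mul_exp_le hs
    (fun (p : Fin m × Fin d) x => t * ((coeff (S := ℤ) (v p.1) p.2 : ℤ) : ℝ) * x)
    (fun p => Real.exp (s ^ 2 * (t * ((coeff (S := ℤ) (v p.1) p.2 : ℤ) : ℝ)) ^ 2 / 2))
    (fun _ => (Real.exp_pos _).le) (fun _ => tsum_gauss_mul_exp_le _ hs)
  refine (le_of_eq (tsum_congr fun a => ?_)).trans (h.trans (le_of_eq ?_))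
  · congr 3
    rw [innerZ, Fintype.sum_prod_type, Finset.mul_sum]
    refine Finset.sum_congr rfl fun j _ => ?_
    rw [Finset.mul_sum]
    refine Finset.sum_congr rfl fun i _ => ?_
    simp only [ringVecEquiv, Equiv.coe_fn_mk, coeff_ofCoeffs]
    ring
  · rw [← Real.exp_sum, ← Finset.sum_div, ← innerZ_self, innerZ, Fintype.sum_prod_type,
      Finset.mul_sum]
    congr 3
    refine Finset.sum_congr rfl fun j _ => ?_
    rw [Finset.mul_sum]
    refine Finset.sum_congr rfl fun i _ => ?_
    ring

theorem tsum_gaussRing_mul_exp_sq_le {s : ℝ} (hs : 0 < s) :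
    ∑' z : Fin m → RZ d,
        gaussRing d m s hs z * ENNReal.ofReal (Real.exp (normZ z ^ 2 / (4 * s ^ 2))) ≤
      ENNReal.ofReal (√2 ^ (m * d)) := by
  rw [tsum_gaussRing_mul]
  have h := tsum_discreteGaussian_mul_exp_le hs
    (fun (_ : Fin m × Fin d) x => (x : ℝ) ^ 2 / (4 * s ^ 2)) (fun _ => √2)
    (fun _ => Real.sqrt_nonneg _) (fun _ => tsum_gauss_mul_exp_sq_le hs)
  refine (le_of_eq (tsum_congr fun a => ?_)).trans (h.trans (le_of_eq ?_))
  · rw [← sum_sq_ringVecEquiv_symm, Equiv.symm_apply_apply, Finset.sum_div]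
  · simp

/-- The tail of the norm of a Gaussian vector. -/
theorem tsum_gaussRing_tail_le {s : ℝ} (hs : 0 < s) (m d : ℕ) [NeZero d] :
    ∑' z : Fin m → RZ d, gaussRing d m s hs z *
        {z : Fin m → RZ d | s * √(2 * (m * d)) < normZ z}.indicator (1 : (Fin m → RZ d) → ℝ≥0∞) z ≤
      ENNReal.ofReal ((2 : ℝ) ^ (-((m * d : ℝ) / 8))) := by
  -- Markov's inequality for exp(‖z‖²/(4s²)), which is at least exp(md/2) beyond the threshold.
  have h1 : ∀ z : Fin m → RZ d, {z : Fin m → RZ d | s * √(2 * (m * d)) < normZ z}.indicator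
      (1 : (Fin m → RZ d) → ℝ≥0∞) z ≤ ENNReal.ofReal (Real.exp (normZ z ^ 2 / (4 * s ^ 2))) *
        ENNReal.ofReal (Real.exp (-((m * d : ℝ) / 2))) := by
    intro z
    by_cases hz : s * √(2 * (m * d)) < normZ z
    · rw [Set.indicator_of_mem (by exact hz), Pi.one_apply,
        ← ENNReal.ofReal_mul (Real.exp_pos _).le, ← Real.exp_add, ENNReal.one_le_ofReal,
        Real.one_le_exp_iff]
      have h2 : s ^ 2 * (2 * (m * d)) ≤ normZ z ^ 2 := by
        have := pow_le_pow_left₀ (by positivity) hz.le 2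
        rwa [mul_pow, Real.sq_sqrt (by positivity)] at this
      have h3 : (m * d : ℝ) / 2 ≤ normZ z ^ 2 / (4 * s ^ 2) := by
        rw [le_div_iff₀ (by positivity)]
        linarith
      linarith
    · rw [Set.indicator_of_notMem (by exact hz)]
      exact zero_le
  calc _ ≤ ∑' z : Fin m → RZ d, gaussRing d m s hs z *
        ENNReal.ofReal (Real.exp (normZ z ^ 2 / (4 * s ^ 2))) *
        ENNReal.ofReal (Real.exp (-((m * d : ℝ) / 2))) := by
        refine ENNReal.tsum_le_tsum fun z => ?_
        rw [mul_assoc]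
        gcongr
        exact h1 z
    _ ≤ ENNReal.ofReal (√2 ^ (m * d)) * ENNReal.ofReal (Real.exp (-((m * d : ℝ) / 2))) := by
        rw [ENNReal.tsum_mul_right]
        gcongr
        exact tsum_gaussRing_mul_exp_sq_le hs
    _ ≤ _ := by
        rw [← ENNReal.ofReal_mul (by positivity)]
        refine ENNReal.ofReal_le_ofReal ?_
        have h4 : √2 ^ (m * d) = Real.exp (Real.log 2 * ((m * d : ℝ) / 2)) := by
          rw [Real.sqrt_eq_rpow, ← Real.rpow_natCast, ← Real.rpow_mul zero_le_two,
            Real.rpow_def_of_pos zero_lt_two]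
          push_cast
          ring_nf
        rw [h4, ← Real.exp_add, Real.rpow_def_of_pos zero_lt_two]
        refine Real.exp_le_exp.2 ?_
        -- The exponent (log 2 - 1)/2 per coordinate is at most -(log 2)/8 because log 2 ≤ 4/5.
        have h5 := Real.log_two_lt_d9
        have h6 : (0 : ℝ) ≤ m * d := by positivity
        nlinarith

end GaussRing

/-! ### Expectations of test functions under a `PMF` -/

section Expectation

variable {α β : Type}

/-- The expectation of a nonnegative function. -/
def expect (p : PMF α) (φ : α → ℝ≥0∞) : ℝ≥0∞ := ∑' a, p a * φ a

theorem expect_bind (p : PMF α) (f : α → PMF β) (φ : β → ℝ≥0∞) :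
    expect (p.bind f) φ = expect p fun a => expect (f a) φ := by
  simp only [expect, PMF.bind_apply, ← ENNReal.tsum_mul_right, ← ENNReal.tsum_mul_left]
  rw [ENNReal.tsum_comm]
  simp only [mul_assoc]

theorem expect_pure (a : α) (φ : α → ℝ≥0∞) : expect (PMF.pure a) φ = φ a := by
  rw [expect, tsum_eq_single a]
  · simp
  · intro b hb
    simp [PMF.pure_apply, hb]

theorem expect_map (p : PMF α) (f : α → β) (φ : β → ℝ≥0∞) :
    expect (p.map f) φ = expect p fun a => φ (f a) := by
  rw [← PMF.bind_pure_comp, expect_bind]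
  simp [expect_pure]

theorem expect_mono (p : PMF α) {φ ψ : α → ℝ≥0∞} (h : ∀ a, φ a ≤ ψ a) :
    expect p φ ≤ expect p ψ :=
  ENNReal.tsum_le_tsum fun a => mul_le_mul' le_rfl (h a)

theorem expect_mono_of_mem_support (p : PMF α) {φ ψ : α → ℝ≥0∞}
    (h : ∀ a ∈ p.support, φ a ≤ ψ a) : expect p φ ≤ expect p ψ := by
  refine ENNReal.tsum_le_tsum fun a => ?_
  by_cases ha : p a = 0
  · simp [ha]
  · exact mul_le_mul' le_rfl (h a ((PMF.mem_support_iff _ _).2 ha))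

theorem expect_const (p : PMF α) (c : ℝ≥0∞) : expect p (fun _ => c) = c := by
  rw [expect, ENNReal.tsum_mul_right, PMF.tsum_coe, one_mul]

theorem expect_add (p : PMF α) (φ ψ : α → ℝ≥0∞) :
    expect p (fun a => φ a + ψ a) = expect p φ + expect p ψ := by
  simp only [expect, mul_add, ENNReal.tsum_add]

theorem expect_mul_left (p : PMF α) (c : ℝ≥0∞) (φ : α → ℝ≥0∞) :
    expect p (fun a => c * φ a) = c * expect p φ := by
  simp only [expect, ← ENNReal.tsum_mul_left, mul_left_comm]

theorem expect_comm (p : PMF α) (p' : PMF β) (φ : α → β → ℝ≥0∞) :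
    (expect p fun a => expect p' fun b => φ a b) = expect p' fun b => expect p fun a => φ a b := by
  simp only [expect, ← ENNReal.tsum_mul_left]
  rw [ENNReal.tsum_comm]
  simp only [mul_left_comm]

theorem expect_le_one (p : PMF α) {φ : α → ℝ≥0∞} (h : ∀ a, φ a ≤ 1) : expect p φ ≤ 1 :=
  (expect_mono p h).trans (expect_const p 1).le

theorem prob_eq_expect (p : PMF α) (S : Set α) :
    prob p S = (expect p (S.indicator 1)).toReal := by
  rw [prob, PMF.toOuterMeasure_apply, expect]
  congr 1
  refine tsum_congr fun a => ?_
  by_cases ha : a ∈ S <;> simp [ha]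

theorem prob_singleton (p : PMF α) (a : α) : prob p {a} = (p a).toReal := by
  rw [prob, PMF.toOuterMeasure_apply_singleton]

theorem prob_bind_true (p : PMF α) (D : α → PMF Bool) :
    prob (p.bind D) {true} = (expect p fun a => D a true).toReal := by
  rw [prob_singleton, PMF.bind_apply, expect]

theorem indicator_one_le_one (S : Set α) (a : α) : S.indicator (1 : α → ℝ≥0∞) a ≤ 1 :=
  Set.indicator_le_self' (fun _ _ => zero_le) a

end Expectation

/-! ### Rejection sampling for one fixed shift -/

section Rejection

variable {d m : ℕ} [NeZero d]

theorem normZ_sub_sq (z v : Fin m → RZ d) :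
    normZ (z - v) ^ 2 = normZ z ^ 2 + (-2 * innerZ z v + normZ v ^ 2) := by
  simp only [← innerZ_self, innerZ, Pi.sub_apply, coeff_sub, Int.cast_sub, Finset.mul_sum,
    ← Finset.sum_add_distrib]
  refine Finset.sum_congr rfl fun j _ => Finset.sum_congr rfl fun i _ => ?_
  ring

theorem gaussRing_eq_mul_sub {s : ℝ} (hs : 0 < s) (z v : Fin m → RZ d) :
    gaussRing d m s hs z = gaussRing d m s hs (z - v) *
      ENNReal.ofReal (Real.exp ((-2 * innerZ z v + normZ v ^ 2) / (2 * s ^ 2))) := by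
  rw [gaussRing_eq, gaussRing_eq, mul_right_comm, ← ENNReal.ofReal_mul (Real.exp_pos _).le,
    ← Real.exp_add, normZ_sub_sq]
  congr 3
  ring

/-- Rejection turns the shifted Gaussian into the minimum of the two densities. -/
theorem gaussRing_sub_mul_rejAcceptProb {s : ℝ} (hs : 0 < s) (z v : Fin m → RZ d) :
    gaussRing d m s hs (z - v) * ENNReal.ofReal (rejAcceptProb z v s) =
      min (gaussRing d m s hs (z - v)) (gaussRing d m s hs z * ENNReal.ofReal (1 / 3)) := by
  rw [rejAcceptProb, ENNReal.ofReal_min, mul_min, ENNReal.ofReal_one, mul_one,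
    gaussRing_eq_mul_sub hs z v, mul_assoc, ← ENNReal.ofReal_mul (Real.exp_pos _).le,
    mul_comm (1 / 3 : ℝ)]

/-- The precision needed is log 3 - 1/242 > 12/11: this is the threshold at which the rejection
estimate yields the exponent 144 = 132 · 12/11. -/
theorem log_three_gt : (1.0951 : ℝ) < Real.log 3 := by
  rw [Real.lt_log_iff_exp_lt (by norm_num)]
  have h : Real.exp 1.0951 ^ 21 < 3 ^ 21 := by
    calc Real.exp 1.0951 ^ 21 ≤ Real.exp 1 ^ 23 := by
          rw [← Real.exp_nat_mul, ← Real.exp_nat_mul]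
          exact Real.exp_le_exp.2 (by norm_num)
      _ ≤ 2.7182818286 ^ 23 :=
          pow_le_pow_left₀ (Real.exp_pos _).le Real.exp_one_lt_d9.le 23
      _ < 3 ^ 21 := by norm_num
  exact lt_of_pow_lt_pow_left₀ 21 (by norm_num) h

theorem exp_neg_seventyTwo_le : Real.exp (-72) ≤ (2 : ℝ)⁻¹ ^ 102 := by
  have h : (2 : ℝ) ^ 17 ≤ Real.exp 12 := by
    have h1 : Real.exp 12 = Real.exp 1 ^ 12 := by
      rw [← Real.exp_nat_mul]
      norm_num
    rw [h1]
    refine le_trans ?_ (pow_le_pow_left₀ (by norm_num) Real.exp_one_gt_d9.le 12)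
    norm_num
  have h2 : Real.exp (-72) = ((Real.exp 12) ^ 6)⁻¹ := by
    rw [← Real.exp_nat_mul, ← Real.exp_neg]
    norm_num
  rw [h2, inv_pow]
  refine inv_anti₀ (by positivity) ?_
  refine le_trans (le_of_eq ?_) (pow_le_pow_left₀ (by norm_num) h 6)
  norm_num

/-- The mass that the minimum misses is tiny once `s ≥ 11 ‖v‖`. -/
theorem gaussRing_le_min_add {s : ℝ} (hs : 0 < s) (z v : Fin m → RZ d) (hv : 11 * normZ v ≤ s) :
    gaussRing d m s hs z * ENNReal.ofReal (1 / 3) ≤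
      min (gaussRing d m s hs (z - v)) (gaussRing d m s hs z * ENNReal.ofReal (1 / 3)) +
        gaussRing d m s hs z * ENNReal.ofReal (Real.exp (-(132 / s ^ 2) * innerZ z v)) *
          ENNReal.ofReal (1 / 3 * Real.exp (-144)) := by
  by_cases h : gaussRing d m s hs z * ENNReal.ofReal (1 / 3) ≤ gaussRing d m s hs (z - v)
  · rw [min_eq_right h]
    exact le_self_add
  refine le_trans ?_ le_add_self
  rw [mul_assoc]
  refine mul_le_mul' le_rfl ?_
  rw [← ENNReal.ofReal_mul (Real.exp_pos _).le]
  refine ENNReal.ofReal_le_ofReal ?_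
  -- Otherwise D(z) ≤ 3 D(z - v), and the minimum would lose nothing at z.
  have hlt : 3 < Real.exp ((-2 * innerZ z v + normZ v ^ 2) / (2 * s ^ 2)) := by
    by_contra hle
    refine h ?_
    rw [gaussRing_eq_mul_sub hs z v, mul_assoc, ← ENNReal.ofReal_mul (Real.exp_pos _).le]
    refine mul_le_of_le_one_right' (ENNReal.ofReal_le_one.2 ?_)
    linarith
  have hlog := (Real.log_lt_log (by norm_num) hlt)
  rw [Real.log_exp, lt_div_iff₀ (by positivity)] at hlog
  have h3 := log_three_gt
  have hv2 : 121 * normZ v ^ 2 ≤ s ^ 2 := by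
    have := pow_le_pow_left₀ (mul_nonneg (by norm_num) (normZ_nonneg v)) hv 2
    nlinarith
  have hs2 : 0 < s ^ 2 := by positivity
  -- The density ratio above 3 and ‖v‖² ≤ s²/121 give -⟨z,v⟩ > (log 3 - 1/242) s² > (12/11) s².
  have hexp : 144 ≤ -(132 / s ^ 2) * innerZ z v := by
    have h4 : -(132 / s ^ 2) * innerZ z v = (-(132 * innerZ z v)) / s ^ 2 := by ring
    rw [h4, le_div_iff₀ hs2]
    nlinarith
  have h5 : 1 ≤ Real.exp (-(132 / s ^ 2) * innerZ z v) * Real.exp (-144) := by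
    rw [← Real.exp_add, Real.one_le_exp_iff]
    linarith
  linarith

/-- The Chernoff parameter 132/s² is optimal for the deviation (12/11) s² when ‖v‖ = s/11. The
moment contributes 132²/(2 · 121) = 72, which leaves e^(72 - 144) = e^(-72). -/
theorem tsum_gaussRing_error_le {s : ℝ} (hs : 0 < s) (v : Fin m → RZ d) (hv : 11 * normZ v ≤ s) :
    ∑' z, gaussRing d m s hs z * ENNReal.ofReal (Real.exp (-(132 / s ^ 2) * innerZ z v)) *
        ENNReal.ofReal (1 / 3 * Real.exp (-144)) ≤ ENNReal.ofReal ((2 : ℝ)⁻¹ ^ 102 / 3) := by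
  rw [ENNReal.tsum_mul_right]
  refine (mul_le_mul' (tsum_gaussRing_mul_exp_inner_le hs _ v) le_rfl).trans ?_
  rw [← ENNReal.ofReal_mul (Real.exp_pos _).le]
  refine ENNReal.ofReal_le_ofReal ?_
  have hv2 : 121 * normZ v ^ 2 ≤ s ^ 2 := by
    have := pow_le_pow_left₀ (mul_nonneg (by norm_num) (normZ_nonneg v)) hv 2
    nlinarith
  have h1 : s ^ 2 * (-(132 / s ^ 2)) ^ 2 * normZ v ^ 2 / 2 ≤ 72 := by
    have : s ^ 2 * (-(132 / s ^ 2)) ^ 2 * normZ v ^ 2 / 2 = 8712 * normZ v ^ 2 / s ^ 2 := by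
      field_simp
      ring
    rw [this, div_le_iff₀ (by positivity)]
    linarith
  have h2 : Real.exp 72 * Real.exp (-144) = Real.exp (-72) := by
    rw [← Real.exp_add]
    norm_num
  have h3 := exp_neg_seventyTwo_le
  have h4 := mul_le_mul_of_nonneg_right (Real.exp_le_exp.2 h1) (Real.exp_pos (-144)).le
  linarith

end Rejection

/-! ### The honest interaction compared with the ideal experiment -/

section HonestRun

variable {q d κ m : ℕ} {PT : Type} [Fintype PT]

/-- The transcript determined by a challenge and a response. -/
def transcriptOf (x : Stmt q d κ m PT) (c : Rq q d) (z : Fin m → Rq q d) : Transcript q d κ m where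
  w := x.A.mulVec z - c • ∑ i, (x.com i).com0
  u := x.B ⬝ᵥ z - c * ∑ i, (x.com i).com 2
  c := c
  z := z

/-- Reduction modulo `q` of a vector. -/
def redVec (q : ℕ) (z : Fin m → RZ d) : Fin m → Rq q d := fun j => red q d (z j)

theorem redVec_add (x y : Fin m → RZ d) : redVec q (x + y) = redVec q x + redVec q y := by
  ext j
  simp [redVec]

theorem redVec_sum {ι : Type} (t : Finset ι) (f : ι → Fin m → RZ d) :
    redVec q (∑ i ∈ t, f i) = ∑ i ∈ t, redVec q (f i) := by
  ext j
  simp [redVec, Finset.sum_apply]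

/-- Expectations over ideal transcripts. -/
def idealExpect {s : ℝ} (hs : 0 < s) (C : PMF (Rq q d)) (x : Stmt q d κ m PT)
    (φ : Transcript q d κ m → ℝ≥0∞) : ℝ≥0∞ :=
  expect C fun c => expect (gaussRing d m s hs) fun z => φ (transcriptOf x c (redVec q z))

theorem idealExpect_le_one {s : ℝ} {hs : 0 < s} {C : PMF (Rq q d)} {x : Stmt q d κ m PT}
    {φ : Transcript q d κ m → ℝ≥0∞} (hφ : ∀ t, φ t ≤ 1) :
    idealExpect hs C x φ ≤ 1 :=
  expect_le_one _ fun _ => expect_le_one _ fun _ => hφ _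

variable [NeZero d]

theorem redVec_lift_smul (c : Rq q d) (x : Fin m → RZ d) :
    redVec q (lift c • x) = c • redVec q x := by
  ext j
  simp [redVec, red_lift]

theorem HonestInput.mulVec_eq {s : ℝ} {ω : ℕ} {x : Stmt q d κ m PT} {r : PT → Fin m → RZ d}
    {msg : PT → Fin 3 → Rq q d} (h : HonestInput s ω x r msg) :
    x.A.mulVec (redVec q (∑ i, r i)) = ∑ i, (x.com i).com0 := by
  rw [redVec_sum, ← Matrix.mulVecLin_apply, map_sum]
  refine Finset.sum_congr rfl fun i _ => ?_
  rw [h.1 i]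
  rfl

/-- Summing the commitments cancels the messages of the last slot, so the sum is a commitment to
zero under ∑ r_i. -/
theorem HonestInput.dotProduct_eq {s : ℝ} {ω : ℕ} {x : Stmt q d κ m PT} {r : PT → Fin m → RZ d}
    {msg : PT → Fin 3 → Rq q d} (h : HonestInput s ω x r msg) :
    x.B ⬝ᵥ (redVec q (∑ i, r i)) = ∑ i, (x.com i).com 2 := by
  rw [redVec_sum, dotProduct_sum, ← add_zero (∑ i, x.B ⬝ᵥ redVec q (r i)), ← h.2.1,
    ← Finset.sum_add_distrib]
  refine Finset.sum_congr rfl fun i _ => ?_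
  rw [h.1 i]
  rfl

theorem expect_rej_map {α : Type} (z v : Fin m → RZ d) (s : ℝ) (g : Bool → α) (φ : α → ℝ≥0∞)
    (h : φ (g false) = 0) :
    expect ((rej z v s).map g) φ = ENNReal.ofReal (rejAcceptProb z v s) * φ (g true) := by
  rw [expect_map, expect, tsum_bool, h, mul_zero, zero_add]
  rfl

/-- Expectations over the honest interaction, for functions that vanish on aborts. -/
theorem expect_honestRun {s : ℝ} (hs : 0 < s) (C : PMF (Rq q d)) (x : Stmt q d κ m PT)
    (r : Fin m → RZ d) (h0 : x.A.mulVec (redVec q r) = ∑ i, (x.com i).com0)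
    (h3 : x.B ⬝ᵥ (redVec q r) = ∑ i, (x.com i).com 2)
    (φ : Option (Transcript q d κ m) → ℝ≥0∞) (hφ : φ none = 0) :
    expect (honestRun s hs C x r) φ = expect C fun c => ∑' z : Fin m → RZ d,
      min (gaussRing d m s hs (z - lift c • r)) (gaussRing d m s hs z * ENNReal.ofReal (1 / 3)) *
        φ (some (transcriptOf x c (redVec q z))) := by
  rw [honestRun, expect_bind]
  simp_rw [expect_bind]
  rw [expect_comm]
  congr 1
  funext c
  -- Change of variable y = z - c r, so that the sum runs over responses.
  rw [expect, ← (Equiv.subRight (lift c • r)).tsum_eq]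
  refine tsum_congr fun z => ?_
  rw [expect_rej_map _ _ _ _ _ (by simpa using hφ), Equiv.subRight_apply, sub_add_cancel,
    ← mul_assoc, gaussRing_sub_mul_rejAcceptProb, if_pos rfl]
  congr 3
  have hz : redVec q (z - lift c • r) = redVec q z - c • redVec q r := by
    rw [eq_sub_iff_add_eq, ← redVec_lift_smul, ← redVec_add, sub_add_cancel]
  rw [transcriptOf, ← h0, ← h3]
  congr 1
  · change x.A.mulVec (redVec q (z - lift c • r)) = _
    rw [hz, Matrix.mulVec_sub, Matrix.mulVec_smul]
  · change x.B ⬝ᵥ redVec q (z - lift c • r) = _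
    rw [hz, dotProduct_sub, dotProduct_smul, smul_eq_mul]

variable {s : ℝ} {hs : 0 < s} {C : PMF (Rq q d)} {x : Stmt q d κ m PT} {ω : ℕ}
  {r : PT → Fin m → RZ d} {msg : PT → Fin 3 → Rq q d}

theorem expect_honestRun_le (h : HonestInput s ω x r msg)
    (φ : Option (Transcript q d κ m) → ℝ≥0∞) (hφ : φ none = 0) :
    expect (honestRun s hs C x (∑ i, r i)) φ ≤
      idealExpect hs C x (fun t => φ (some t)) * ENNReal.ofReal (1 / 3) := by
  rw [expect_honestRun hs C x _ h.mulVec_eq h.dotProduct_eq φ hφ, idealExpect, mul_comm,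
    ← expect_mul_left]
  refine expect_mono _ fun c => ?_
  rw [expect, ← ENNReal.tsum_mul_left]
  refine ENNReal.tsum_le_tsum fun z => ?_
  rw [← mul_assoc, mul_comm (ENNReal.ofReal (1 / 3))]
  exact mul_le_mul' (min_le_right _ _) le_rfl

/-- The converse of `expect_honestRun_le`, up to the mass missed by the minimum. Every challenge in
the support has ‖c r‖ ≤ ω‖r‖ ≤ s/11, so the error bound is uniform in c. -/
theorem idealExpect_le_expect_honestRun (h : HonestInput s ω x r msg)
    (hC : ∀ c ∈ C.support, l1 c ≤ ω)
    (φ : Option (Transcript q d κ m) → ℝ≥0∞) (hφ : φ none = 0) (hφ1 : ∀ o, φ o ≤ 1) :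
    idealExpect hs C x (fun t => φ (some t)) * ENNReal.ofReal (1 / 3) ≤
      expect (honestRun s hs C x (∑ i, r i)) φ + ENNReal.ofReal ((2 : ℝ)⁻¹ ^ 102 / 3) := by
  rw [expect_honestRun hs C x _ h.mulVec_eq h.dotProduct_eq φ hφ, idealExpect, mul_comm,
    ← expect_mul_left, ← expect_const C (ENNReal.ofReal ((2 : ℝ)⁻¹ ^ 102 / 3)), ← expect_add]
  refine expect_mono_of_mem_support _ fun c hc => ?_
  have hv : 11 * normZ (lift c • ∑ i, r i) ≤ s := by
    have h1 := normZ_lift_smul_le c (∑ i, r i)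
    have h2 : (l1 c : ℝ) * normZ (∑ i, r i) ≤ ω * normZ (∑ i, r i) :=
      mul_le_mul_of_nonneg_right (by exact_mod_cast hC c hc) (normZ_nonneg _)
    have h3 := h.2.2
    linarith
  refine le_trans ?_ (add_le_add le_rfl (tsum_gaussRing_error_le hs _ hv))
  rw [← ENNReal.tsum_add, expect, ← ENNReal.tsum_mul_left]
  refine ENNReal.tsum_le_tsum fun z => ?_
  rw [← mul_assoc, mul_comm (ENNReal.ofReal (1 / 3))]
  refine (mul_le_mul' (gaussRing_le_min_add hs z _ hv) le_rfl).trans ?_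
  rw [add_mul]
  exact add_le_add le_rfl (mul_le_of_le_one_right' (hφ1 _))

theorem honestRun_bounds (h : HonestInput s ω x r msg) (hC : ∀ c ∈ C.support, l1 c ≤ ω)
    (φ : Option (Transcript q d κ m) → ℝ≥0∞) (hφ : φ none = 0) (hφ1 : ∀ o, φ o ≤ 1) :
    (expect (honestRun s hs C x (∑ i, r i)) φ).toReal ≤
        (idealExpect hs C x fun t => φ (some t)).toReal / 3 ∧
      (idealExpect hs C x fun t => φ (some t)).toReal / 3 ≤
        (expect (honestRun s hs C x (∑ i, r i)) φ).toReal + (2 : ℝ)⁻¹ ^ 102 / 3 := by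
  have hI : idealExpect hs C x (fun t => φ (some t)) ≠ ⊤ :=
    ((idealExpect_le_one fun t => hφ1 (some t)).trans_lt ENNReal.one_lt_top).ne
  have hH : expect (honestRun s hs C x (∑ i, r i)) φ ≠ ⊤ :=
    ((expect_le_one _ hφ1).trans_lt ENNReal.one_lt_top).ne
  have h3 : (ENNReal.ofReal (1 / 3)).toReal = 1 / 3 := ENNReal.toReal_ofReal (by norm_num)
  constructor
  · have := ENNReal.toReal_mono (ENNReal.mul_ne_top hI ENNReal.ofReal_ne_top)
      (expect_honestRun_le (hs := hs) (C := C) h φ hφ)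
    rw [ENNReal.toReal_mul, h3] at this
    linarith
  · have := ENNReal.toReal_mono (ENNReal.add_ne_top.2 ⟨hH, ENNReal.ofReal_ne_top⟩)
      (idealExpect_le_expect_honestRun (hs := hs) h hC φ hφ hφ1)
    rw [ENNReal.toReal_mul, h3, ENNReal.toReal_add hH ENNReal.ofReal_ne_top,
      ENNReal.toReal_ofReal (by positivity)] at this
    linarith

theorem prob_isSome_bounds (h : HonestInput s ω x r msg) (hC : ∀ c ∈ C.support, l1 c ≤ ω) :
    prob (honestRun s hs C x (∑ i, r i)) {o | o.isSome} ≤ 1 / 3 ∧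
      (1 - (2 : ℝ)⁻¹ ^ 102) / 3 ≤ prob (honestRun s hs C x (∑ i, r i)) {o | o.isSome} := by
  have := honestRun_bounds (hs := hs) h hC ({o | o.isSome}.indicator 1) (by simp)
    (indicator_one_le_one _)
  -- The ideal experiment never aborts.
  have h1 : (idealExpect hs C x fun t =>
      {o : Option (Transcript q d κ m) | o.isSome}.indicator
        (1 : Option (Transcript q d κ m) → ℝ≥0∞) (some t)) = 1 := by
    simp [idealExpect, expect_const]
  rw [h1, ENNReal.toReal_one, ← prob_eq_expect] at this
  constructor <;> linarith

/-- Conditioning on not aborting changes probabilities by at most `2^{-100}/3`. -/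
theorem abs_conditional_sub_ideal_le (h : HonestInput s ω x r msg)
    (hC : ∀ c ∈ C.support, l1 c ≤ ω) (φ : Option (Transcript q d κ m) → ℝ≥0∞)
    (hφ : φ none = 0) (hφ1 : ∀ o, φ o ≤ 1) :
    |(expect (honestRun s hs C x (∑ i, r i)) φ).toReal /
        prob (honestRun s hs C x (∑ i, r i)) {o | o.isSome} -
      (idealExpect hs C x fun t => φ (some t)).toReal| ≤ (2 : ℝ)⁻¹ ^ 100 / 3 := by
  obtain ⟨h1, h2⟩ := honestRun_bounds (hs := hs) h hC φ hφ hφ1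
  obtain ⟨h3, h4⟩ := prob_isSome_bounds (hs := hs) h hC
  set H := (expect (honestRun s hs C x (∑ i, r i)) φ).toReal
  set P := prob (honestRun s hs C x (∑ i, r i)) {o | o.isSome}
  set I := (idealExpect hs C x fun t => φ (some t)).toReal
  have hI0 : 0 ≤ I := ENNReal.toReal_nonneg
  have hI1 : I ≤ 1 := ENNReal.toReal_le_of_le_ofReal zero_le_one
    (by simpa using idealExpect_le_one fun t => hφ1 (some t))
  have hH0 : 0 ≤ H := ENNReal.toReal_nonneg
  -- Two spare bits pay for the division by the non-abort probability, which lies between (1 - η)/3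
  -- and 1/3 for η = 2^(-102).
  have e : (2 : ℝ)⁻¹ ^ 100 = 4 * (2 : ℝ)⁻¹ ^ 102 := by norm_num
  have he : (2 : ℝ)⁻¹ ^ 102 ≤ 1 / 16 := by norm_num
  have he0 : (0 : ℝ) < (2 : ℝ)⁻¹ ^ 102 := by positivity
  rw [e]
  generalize (2 : ℝ)⁻¹ ^ 102 = η at *
  have hP : 0 < P := by linarith
  rw [abs_le]
  constructor
  · have : I - η ≤ H / P := by
      rw [le_div_iff₀ hP]
      nlinarith
    linarith
  · have : H / P ≤ I + 4 * η / 3 := by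
      rw [div_le_iff₀ hP]
      nlinarith
    linarith

theorem transcriptOf_accepts_iff (c : Rq q d) (z : Fin m → Rq q d) :
    Accepts s x (transcriptOf x c z) ↔ l2 z ≤ s * √(2 * (m * d)) := by
  simp [Accepts, transcriptOf]

/-- Ideal transcripts satisfy both linear checks by construction, so only the norm check can fail;
the Gaussian tail bounds that, as reduction modulo q does not lengthen z. -/
theorem one_sub_le_idealExpect_accepts [NeZero q] :
    1 - (2 : ℝ) ^ (-((m * d : ℝ) / 8)) ≤
      (idealExpect hs C x ({t | Accepts s x t}.indicator 1)).toReal := by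
  have h : (1 : ℝ≥0∞) ≤ idealExpect hs C x ({t | Accepts s x t}.indicator 1) +
      ENNReal.ofReal ((2 : ℝ) ^ (-((m * d : ℝ) / 8))) := by
    rw [← expect_const C (ENNReal.ofReal ((2 : ℝ) ^ (-((m * d : ℝ) / 8)))), idealExpect,
      ← expect_add, ← expect_const C 1]
    refine expect_mono _ fun c => ?_
    refine le_trans ?_ (add_le_add le_rfl (tsum_gaussRing_tail_le hs m d))
    rw [← expect, ← expect_add, ← expect_const (gaussRing d m s hs) 1]
    refine expect_mono _ fun z => ?_
    by_cases hz : s * √(2 * (m * d)) < normZ z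
    · rw [Set.indicator_of_mem (s := {z : Fin m → RZ d | s * √(2 * (m * d)) < normZ z}) hz]
      exact le_add_self
    · rw [Set.indicator_of_mem]
      · exact le_self_add
      · exact (transcriptOf_accepts_iff c _).2 ((l2_red_le z).trans (not_lt.1 hz))
  have hI : idealExpect hs C x ({t | Accepts s x t}.indicator 1) ≠ ⊤ :=
    ((idealExpect_le_one (indicator_one_le_one _)).trans_lt ENNReal.one_lt_top).ne
  have := ENNReal.toReal_mono (ENNReal.add_ne_top.2 ⟨hI, ENNReal.ofReal_ne_top⟩) h
  rw [ENNReal.toReal_add hI ENNReal.ofReal_ne_top, ENNReal.toReal_ofReal (by positivity),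
    ENNReal.toReal_one] at this
  linarith

end HonestRun

/-! ### Openings and Module-SIS solutions from accepting transcripts -/

section Extraction

/-- Short kernel vectors of the shape `a • y - b • y'`. -/
theorem isMSISSolution_smul_sub {q d κ m : ℕ} [NeZero d] [NeZero q] {ω : ℕ}
    {A : Matrix (Fin κ) (Fin m) (Rq q d)} {a b : Rq q d} {y y' : Fin m → Rq q d} {β : ℝ}
    (ha : l1 a ≤ 2 * ω) (hb : l1 b ≤ 2 * ω) (hy : l2 y ≤ 2 * β) (hy' : l2 y' ≤ 2 * β)
    (hA : A.mulVec (a • y - b • y') = 0) (hne : a • y - b • y' ≠ 0) :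
    IsMSISSolution A (8 * ω * β) (a • y - b • y') := by
  refine ⟨hA, l2_pos hne, ?_⟩
  have ha' : (l1 a : ℝ) ≤ 2 * ω := by exact_mod_cast ha
  have hb' : (l1 b : ℝ) ≤ 2 * ω := by exact_mod_cast hb
  have h1 := l2_sub_le (a • y) (b • y')
  have h2 := (l2_smul_le a y).trans (mul_le_mul ha' hy (l2_nonneg _) (by positivity))
  have h3 := (l2_smul_le b y').trans (mul_le_mul hb' hy' (l2_nonneg _) (by positivity))
  linarith

variable {q d κ m : ℕ} {PT : Type} [NeZero d] [Fintype PT]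
  {s : ℝ} {ω : ℕ} {x : Stmt q d κ m PT} {w : Fin κ → Rq q d} {u c c' : Rq q d}
  {z z' : Fin m → Rq q d}

theorem Accepts.mulVec_sub (h : Accepts s x ⟨w, u, c, z⟩) (h' : Accepts s x ⟨w, u, c', z'⟩) :
    x.A.mulVec (z - z') = (c - c') • ∑ i, (x.com i).com0 := by
  rw [Matrix.mulVec_sub, h.2.1, h'.2.1, sub_smul]
  exact add_sub_add_left_eq_sub _ _ _

theorem Accepts.dotProduct_sub (h : Accepts s x ⟨w, u, c, z⟩)
    (h' : Accepts s x ⟨w, u, c', z'⟩) :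
    x.B ⬝ᵥ (z - z') = (c - c') * ∑ i, (x.com i).com 2 := by
  rw [_root_.dotProduct_sub, h.2.2, h'.2.2, sub_mul]
  exact add_sub_add_left_eq_sub _ _ _

theorem com_sub_eq_zero (h : Accepts s x ⟨w, u, c, z⟩) (h' : Accepts s x ⟨w, u, c', z'⟩)
    (hu : IsUnit (c - c')) :
    (∑ i, (x.com i).com 2) - Ring.inverse (c - c') * (x.B ⬝ᵥ (z - z')) = 0 := by
  rw [h.dotProduct_sub h', Ring.inverse_mul_cancel_left _ _ hu, sub_self]

variable [NeZero q]

theorem Accepts.l2_sub_le (h : Accepts s x ⟨w, u, c, z⟩) (h' : Accepts s x ⟨w, u, c', z'⟩) :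
    l2 (z - z') ≤ 2 * (s * √(2 * (m * d))) := by
  have h1 : l2 z ≤ _ := h.1
  have h2 : l2 z' ≤ _ := h'.1
  have := PoB.l2_sub_le z z'
  linarith

theorem balanceRelation_of_accepts (hc : l1 c ≤ ω) (hc' : l1 c' ≤ ω)
    (h : Accepts s x ⟨w, u, c, z⟩) (h' : Accepts s x ⟨w, u, c', z'⟩) (hu : IsUnit (c - c')) :
    BalanceRelation s ω x ⟨c - c', Ring.inverse (c - c') • (z - z'), 0⟩ := by
  refine ⟨⟨?_, hu, ?_, ?_⟩, rfl⟩
  · exact (l1_sub_le c c').trans (by omega)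
  · have h1 : (fun j => (c - c') * (Ring.inverse (c - c') • (z - z')) j) = z - z' := by
      ext j
      rw [Pi.smul_apply, smul_eq_mul, Ring.mul_inverse_cancel_left _ _ hu]
    have h2 := h.l2_sub_le h'
    rw [← mul_assoc] at h2
    rwa [h1]
  · have h1 : x.A.mulVec (Ring.inverse (c - c') • (z - z')) = ∑ i, (x.com i).com0 := by
      rw [Matrix.mulVec_smul, h.mulVec_sub h', smul_smul, Ring.inverse_mul_cancel _ hu, one_smul]
    have h2 : x.B ⬝ᵥ (Ring.inverse (c - c') • (z - z')) = ∑ i, (x.com i).com 2 := by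
      rw [dotProduct_smul, h.dotProduct_sub h', smul_eq_mul,
        Ring.inverse_mul_cancel_left _ _ hu]
    simp only [commit, Stmt.key03, Stmt.sum03, h1, h2, Pi.zero_apply, add_zero]

/-- All transcripts share w, so A maps z'' - z to (c'' - c) com₀ and z - z' to (c - c') com₀;
cross-multiplication cancels com₀. When the resulting kernel vector is zero, dividing by c - c'
gives the equality. -/
theorem response_eq_or_isMSISSolution (hc : l1 c ≤ ω) (hc' : l1 c' ≤ ω)
    (h : Accepts s x ⟨w, u, c, z⟩) (h' : Accepts s x ⟨w, u, c', z'⟩) (hu : IsUnit (c - c'))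
    {c'' : Rq q d} {z'' : Fin m → Rq q d} (hc'' : l1 c'' ≤ ω)
    (h'' : Accepts s x ⟨w, u, c'', z''⟩) :
    z'' - c'' • (Ring.inverse (c - c') • (z - z')) =
        z - c • (Ring.inverse (c - c') • (z - z')) ∨
      IsMSISSolution x.A (8 * ω * (s * √(2 * (m * d))))
        ((c - c') • (z'' - z) - (c'' - c) • (z - z')) := by
  by_cases h0 : (c - c') • (z'' - z) - (c'' - c) • (z - z') = 0
  · left
    have h1 : z'' - z = (c'' - c) • (Ring.inverse (c - c') • (z - z')) := by
      rw [smul_comm, ← sub_eq_zero.1 h0, smul_smul, Ring.inverse_mul_cancel _ hu, one_smul]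
    rw [sub_smul] at h1
    rw [sub_eq_sub_iff_sub_eq_sub, h1]
  · right
    refine isMSISSolution_smul_sub ((l1_sub_le _ _).trans (by omega))
      ((l1_sub_le _ _).trans (by omega)) (h''.l2_sub_le h) (h.l2_sub_le h') ?_ h0
    rw [Matrix.mulVec_sub, Matrix.mulVec_smul, Matrix.mulVec_smul, h''.mulVec_sub h,
      h.mulVec_sub h', smul_comm, sub_self]

/-- The same cancellation, with c̄₁ r₁ in place of a difference of responses: the opening bounds
that product, not r₁ itself. Once the randomness agrees, the B-row forces the message to be zero. -/
theorem opening_eq_or_isMSISSolution (hc : l1 c ≤ ω) (hc' : l1 c' ≤ ω)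
    (h : Accepts s x ⟨w, u, c, z⟩) (h' : Accepts s x ⟨w, u, c', z'⟩) (hu : IsUnit (c - c'))
    {o : Opening q d m 1} (ho : IsWeakOpening x.key03 x.sum03 s ω o) :
    (o.r = Ring.inverse (c - c') • (z - z') ∧ o.msg = 0) ∨
      IsMSISSolution x.A (8 * ω * (s * √(2 * (m * d))))
        (o.cbar • (z - z') - (c - c') • (o.cbar • o.r)) := by
  obtain ⟨ho1, ho2, ho3, ho4⟩ := ho
  have hcom0 : x.A.mulVec o.r = ∑ i, (x.com i).com0 := congrArg Commitment.com0 ho4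
  have hcom : ∀ k, x.B ⬝ᵥ o.r + o.msg k = ∑ i, (x.com i).com 2 := fun k =>
    congrFun (congrArg Commitment.com ho4) k
  by_cases h0 : o.cbar • (z - z') - (c - c') • (o.cbar • o.r) = 0
  · left
    have hr : o.r = Ring.inverse (c - c') • (z - z') := by
      have h1 : Ring.inverse o.cbar • (o.cbar • (z - z')) =
          Ring.inverse o.cbar • ((c - c') • (o.cbar • o.r)) := by rw [sub_eq_zero.1 h0]
      rw [smul_comm (c - c'), smul_smul, smul_smul, Ring.inverse_mul_cancel _ ho2, one_smul,
        one_smul] at h1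
      rw [h1, smul_smul, Ring.inverse_mul_cancel _ hu, one_smul]
    refine ⟨hr, funext fun k => ?_⟩
    have h2 := hcom k
    rw [hr, dotProduct_smul, h.dotProduct_sub h', smul_eq_mul,
      Ring.inverse_mul_cancel_left _ _ hu] at h2
    simpa using h2
  · right
    refine isMSISSolution_smul_sub ho1 ((l1_sub_le _ _).trans (by omega))
      (h.l2_sub_le h') ?_ ?_ h0
    · rw [← mul_assoc]
      exact ho3
    · rw [Matrix.mulVec_sub, Matrix.mulVec_smul, Matrix.mulVec_smul, Matrix.mulVec_smul,
        h.mulVec_sub h', hcom0, smul_comm, sub_self]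

end Extraction

/-! ### The simulator and the extractor as programs -/

section Programs

/-- The sum of a family of expressions. -/
def Term.sum {V ι : Type} [Fintype ι] (f : ι → Term V) : Term V :=
  ((Finset.univ : Finset ι).toList.map f).foldr .add .zero

theorem Term.eval_sum {R V ι : Type} [CommRing R] [Fintype ι] (env : V → R) (f : ι → Term V) :
    (Term.sum f).eval env = ∑ i, (f i).eval env := by
  have h : ∀ l : List (Term V),
      (l.foldr Term.add Term.zero).eval env = (l.map fun t => t.eval env).sum := by
    intro l
    induction l with
    | nil => rfl
    | cons a l ih => simp [Term.eval, ih]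
  rw [Term.sum, h, List.map_map]
  exact Finset.sum_map_toList _ _

theorem Term.size_sum {V ι : Type} [Fintype ι] (f : ι → Term V) :
    (Term.sum f).size = ∑ i, ((f i).size + 1) + 1 := by
  have h : ∀ l : List (Term V),
      (l.foldr Term.add Term.zero).size = (l.map fun t => t.size + 1).sum + 1 := by
    intro l
    induction l with
    | nil => rfl
    | cons a l ih =>
      simp only [List.foldr_cons, Term.size, ih, List.map_cons, List.sum_cons]
      ring
  rw [Term.sum, h, List.map_map]
  congr 1
  exact Finset.sum_map_toList _ _

variable (κ m : ℕ) (PT : Type)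

/-- Draws the challenge and the response and solves the verification equations for the first
message. -/
def simulator [Fintype PT] : Prog m (TrVar κ m) (InVar κ m PT) :=
  .chal <| .gauss m <| .ret fun
    | .inl i => .sub
        (.sum fun j : Fin m => .mul (.var (.inl (.inl (.A i j)))) (.var (.inr j)))
        (.mul (.var (.inl (.inr ()))) (.sum fun k : PT => .var (.inl (.inl (.com0 k i)))))
    | .inr (.inl _) => .sub
        (.sum fun j : Fin m => .mul (.var (.inl (.inl (.B j)))) (.var (.inr j)))
        (.mul (.var (.inl (.inr ()))) (.sum fun k : PT => .var (.inl (.inl (.com k 2)))))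
    | .inr (.inr (.inl _)) => .var (.inl (.inr ()))
    | .inr (.inr (.inr j)) => .var (.inr j)

/-- Queries the prover on two fresh challenges and divides the difference of the responses by the
difference of the challenges. -/
def extractor : Prog m (WitVar m) (InVar κ m PT) :=
  -- The two queries look identical but differ: variables are named from the most recent binder, so
  -- the second name reaches past the first response to the second challenge.
  .chal <| .chal <| .query (.var (.inl (.inr ()))) <| .query (.var (.inl (.inr ()))) <| .ret fun
    | .inl _ => .sub (.var (.inl (.inl (.inl (.inr ()))))) (.var (.inl (.inl (.inr ()))))
    | .inr (.inl j) => .mul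
        (.inv (.sub (.var (.inl (.inl (.inl (.inr ()))))) (.var (.inl (.inl (.inr ()))))))
        (.sub (.var (.inl (.inr j))) (.var (.inr j)))
    | .inr (.inr _) => .zero

theorem simulator_queries [Fintype PT] : (simulator κ m PT).queries = 0 := rfl

theorem simulator_steps [Fintype PT] :
    (simulator κ m PT).steps ≤ 20 * (κ + 1) * (m + Fintype.card PT + 1) := by
  simp only [simulator, Prog.steps, Fintype.sum_sum_type, Term.size, Term.size_sum,
    Finset.sum_const, Finset.card_univ, Fintype.card_fin, Fintype.card_unit, smul_eq_mul]
  nlinarith [Nat.zero_le (κ * m), Nat.zero_le (κ * Fintype.card PT)]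

theorem extractor_queries : (extractor κ m PT).queries = 2 := rfl

/-- The exact count is 10 m + 10, whence the need for m ≥ 1. -/
theorem extractor_steps (hm : 1 ≤ m) : (extractor κ m PT).steps ≤ 20 * m := by
  simp only [extractor, Prog.steps, Fintype.sum_sum_type, Term.size,
    Finset.sum_const, Finset.card_univ, Fintype.card_fin, Fintype.card_unit, smul_eq_mul]
  omega

end Programs

/-! ### Output distributions of the two programs -/

section Runs

variable {q d κ m : ℕ} {PT : Type} {s : ℝ} {hs : 0 < s} {C : PMF (Rq q d)}
  {x : Stmt q d κ m PT}

theorem expect_extracted (P : Prover q d κ m) (φ : Opening q d m 1 → ℝ≥0∞) :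
    expect (extracted (extractor κ m PT) s hs C x P) φ =
      expect P.tape fun ρ => expect C fun c => expect C fun c' =>
        φ ⟨c - c', Ring.inverse (c - c') • ((P.resp ρ c).getD 0 - (P.resp ρ c').getD 0), 0⟩ := by
  simp only [extracted, expect_bind, expect_map, extractor, Prog.run, expect_pure]
  rfl

/-- The simulator realises the ideal experiment exactly, so the whole zero-knowledge error comes
from the rejection step. -/
theorem expect_simulated [Fintype PT] (φ : Transcript q d κ m → ℝ≥0∞) :
    expect (simulated (simulator κ m PT) s hs C x) φ = idealExpect hs C x φ := by
  simp only [simulated, expect_map, simulator, Prog.run, expect_bind, expect_pure, idealExpect]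
  congr 1
  funext c
  congr 1
  funext y
  congr 1
  simp only [decodeTranscript, transcriptOf, Term.eval, Term.eval_sum, Sum.elim_inl, Sum.elim_inr,
    Stmt.env]
  congr 1
  ext i
  simp [Matrix.mulVec, dotProduct, redVec, Finset.sum_apply]

end Runs

/-! ### Success probability of the extractor -/

section KnowledgeSoundness

variable {q d κ m : ℕ} {PT : Type} {s : ℝ} {hs : 0 < s}
  {C : PMF (Rq q d)} {x : Stmt q d κ m PT} {ω : ℕ}

theorem prob_le_one {α : Type} (p : PMF α) (S : Set α) : prob p S ≤ 1 := by
  rw [prob_eq_expect]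
  exact ENNReal.toReal_le_of_le_ofReal zero_le_one
    (by simpa using expect_le_one p (indicator_one_le_one S))

theorem prob_nonneg {α : Type} (p : PMF α) (S : Set α) : 0 ≤ prob p S := ENNReal.toReal_nonneg

theorem ofReal_prob {α : Type} (p : PMF α) (S : Set α) :
    ENNReal.ofReal (prob p S) = expect p (S.indicator 1) := by
  rw [prob_eq_expect, ENNReal.ofReal_toReal]
  exact ((expect_le_one p (indicator_one_le_one S)).trans_lt ENNReal.one_lt_top).ne

theorem nonInvertibility_nonneg (C : PMF (Rq q d)) : 0 ≤ nonInvertibility C :=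
  Real.iSup_nonneg fun _ => prob_nonneg _ _

theorem expect_not_isUnit_le {c : Rq q d} (hc : c ∈ C.support) :
    expect C ({c' | ¬ IsUnit (c - c')}.indicator 1) ≤ ENNReal.ofReal (nonInvertibility C) := by
  rw [← ofReal_prob]
  refine ENNReal.ofReal_le_ofReal (le_ciSup (f := fun c : {c : Rq q d // c ∈ C.support} =>
    prob C {c' | ¬ IsUnit (c.1 - c')}) ⟨1, ?_⟩ ⟨c, hc⟩)
  rintro _ ⟨c, rfl⟩
  exact prob_le_one _ _

/-- Average the inequality 2eb ≤ b² + e² with e the mean. The bound φ ≤ 1 makes e finite, which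
allows cancellation in `ℝ≥0∞`. -/
theorem sq_expect_le {α : Type} (p : PMF α) {φ : α → ℝ≥0∞} (h : ∀ a, φ a ≤ 1) :
    expect p φ ^ 2 ≤ expect p fun a => φ a ^ 2 := by
  have hE : expect p φ ≠ ⊤ := ((expect_le_one p h).trans_lt ENNReal.one_lt_top).ne
  have key : ∀ a, 2 * expect p φ * φ a ≤ φ a ^ 2 + expect p φ ^ 2 := by
    intro a
    have ha : φ a ≠ ⊤ := ((h a).trans_lt ENNReal.one_lt_top).ne
    lift expect p φ to ℝ≥0 using hE with e
    lift φ a to ℝ≥0 using ha with b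
    have := two_mul_le_add_sq e b
    rw [add_comm] at this
    exact_mod_cast this
  have h1 := expect_mono p key
  rw [expect_mul_left, expect_add, expect_const, mul_assoc, ← sq, two_mul] at h1
  exact (ENNReal.add_le_add_iff_right (ENNReal.pow_ne_top hE)).1 h1

variable [NeZero d] [Fintype PT]

/-- The probability of a convincing answer for a fixed tape. -/
def tapeAcceptProb (s : ℝ) (C : PMF (Rq q d)) (x : Stmt q d κ m PT) (P : Prover q d κ m)
    (ρ : P.Tape) : ℝ≥0∞ :=
  expect C ({c | P.Convinces s x ρ c}.indicator 1)

/-- The square is the probability that two independent challenges are both answered convincingly.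
Either the difference is a unit and extraction works, or it is not; for each accepted first
challenge the latter has probability at most δ. -/
theorem sq_tapeAcceptProb_le [NeZero q] (hC : ∀ c ∈ C.support, l1 c ≤ ω) (P : Prover q d κ m)
    (ρ : P.Tape) :
    tapeAcceptProb s C x P ρ ^ 2 ≤
      (expect C fun c => expect C fun c' => {o | BalanceRelation s ω x o}.indicator 1
        ⟨c - c', Ring.inverse (c - c') • ((P.resp ρ c).getD 0 - (P.resp ρ c').getD 0), 0⟩) +
      ENNReal.ofReal (nonInvertibility C) * tapeAcceptProb s C x P ρ := by
  rw [sq]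
  nth_rw 1 [tapeAcceptProb]
  nth_rw 2 [tapeAcceptProb]
  rw [← expect_mul_left, ← expect_add, mul_comm (expect C _) (tapeAcceptProb s C x P ρ),
    ← expect_mul_left]
  refine expect_mono_of_mem_support C fun c hc => ?_
  by_cases hconv : P.Convinces s x ρ c
  swap
  · simp [hconv]
  rw [Set.indicator_of_mem (by exact hconv), Pi.one_apply, mul_one, mul_one]
  refine le_trans ?_ (add_le_add le_rfl (expect_not_isUnit_le hc))
  rw [tapeAcceptProb, ← expect_add]
  refine expect_mono_of_mem_support C fun c' hc' => ?_
  by_cases hconv' : P.Convinces s x ρ c'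
  swap
  · simp [hconv']
  refine (indicator_one_le_one _ _).trans ?_
  by_cases hu : IsUnit (c - c')
  · obtain ⟨z, hz, hacc⟩ := hconv
    obtain ⟨z', hz', hacc'⟩ := hconv'
    rw [hz, hz', Option.getD_some, Option.getD_some, Set.indicator_of_mem]
    · exact le_self_add
    · exact balanceRelation_of_accepts (hC c hc) (hC c' hc') hacc hacc' hu
  · rw [Set.indicator_of_mem (s := {c' | ¬ IsUnit (c - c')}) (by exact hu)]
    exact le_add_self

theorem knowledge_soundness [NeZero q] (hC : ∀ c ∈ C.support, l1 c ≤ ω) (P : Prover q d κ m)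
    (hP : nonInvertibility C < P.acceptProb s C x) :
    (P.acceptProb s C x - nonInvertibility C) ^ 2 ≤
      prob (extracted (extractor κ m PT) s hs C x P) {o | BalanceRelation s ω x o} := by
  have hle : ∀ ρ, tapeAcceptProb s C x P ρ ≤ 1 := fun ρ =>
    expect_le_one _ (indicator_one_le_one _)
  have hacc : P.acceptProb s C x = (expect P.tape (tapeAcceptProb s C x P)).toReal := by
    rw [Prover.acceptProb, prob_eq_expect, expect_bind]
    simp only [expect_map]
    rfl
  have h1 := (sq_expect_le P.tape hle).trans (expect_mono P.tape (sq_tapeAcceptProb_le hC P))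
  rw [expect_add, expect_mul_left, ← expect_extracted (hs := hs) (x := x), ← ofReal_prob] at h1
  have hE : expect P.tape (tapeAcceptProb s C x P) ≠ ⊤ :=
    ((expect_le_one _ hle).trans_lt ENNReal.one_lt_top).ne
  have h2 := ENNReal.toReal_mono (ENNReal.add_ne_top.2
    ⟨ENNReal.ofReal_ne_top, ENNReal.mul_ne_top ENNReal.ofReal_ne_top hE⟩) h1
  rw [ENNReal.toReal_add ENNReal.ofReal_ne_top (ENNReal.mul_ne_top ENNReal.ofReal_ne_top hE),
    ENNReal.toReal_pow, ENNReal.toReal_mul, ENNReal.toReal_ofReal (prob_nonneg _ _),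
    ENNReal.toReal_ofReal (nonInvertibility_nonneg C), ← hacc] at h2
  have h3 := nonInvertibility_nonneg C
  -- Here ε² ≤ success + δε, and ε(ε - δ) ≥ (ε - δ)² because 0 ≤ δ < ε.
  nlinarith

end KnowledgeSoundness

/-! ### Factors of X^d + 1 and reduction modulo one of them -/

section Factorization

variable {q l n : ℕ} [Fact q.Prime]

theorem pow_eq_neg_one_of_primitive {ζ : ZMod q} (hl : 0 < l) (hζ : IsPrimitiveRoot ζ (2 * l)) :
    ζ ^ l = -1 := by
  have h1 : ζ ^ l * ζ ^ l = 1 := by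
    rw [← pow_add, ← two_mul, hζ.pow_eq_one]
  rcases mul_self_eq_one_iff.1 h1 with h | h
  · exact absurd h (hζ.pow_ne_one_of_pos_of_lt hl.ne' (by omega))
  · exact h

/-- The roots of Y^l + 1 are ζ times the powers of the primitive l-th root ζ²; then substitute Y =
X^n. -/
theorem X_pow_add_one_eq_prod {ζ : ZMod q} (hl : 0 < l) (hζ : IsPrimitiveRoot ζ (2 * l)) :
    (X ^ (l * n) + 1 : (ZMod q)[X]) =
      ∏ j ∈ Finset.range l, (X ^ n - C (ζ ^ (2 * j + 1))) := by
  have h2 : IsPrimitiveRoot (ζ ^ 2) l := hζ.pow (by omega) rfl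
  have h := congrArg (fun f => f.comp (X ^ n))
    (X_pow_sub_C_eq_prod h2 hl (pow_eq_neg_one_of_primitive hl hζ))
  simp only [sub_comp, pow_comp, X_comp, C_comp, prod_comp] at h
  rw [← pow_mul, mul_comm n l, map_neg, map_one, sub_neg_eq_add] at h
  rw [h]
  refine Finset.prod_congr rfl fun j _ => ?_
  rw [pow_succ ζ (2 * j), pow_mul]

/-- A non-unit of `R_q` vanishes modulo one of the factors of `X^d + 1`. -/
theorem exists_dvd_of_not_isUnit {ζ : ZMod q} (hl : 0 < l) (hζ : IsPrimitiveRoot ζ (2 * l))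
    (hirr : ∀ j < l, Irreducible (X ^ n - C (ζ ^ (2 * j + 1)) : (ZMod q)[X]))
    (P : (ZMod q)[X]) (hP : ¬ IsUnit (AdjoinRoot.mk (X ^ (l * n) + 1) P)) :
    ∃ j < l, (X ^ n - C (ζ ^ (2 * j + 1))) ∣ P := by
  by_contra! hcon
  refine hP ?_
  have hcop : IsCoprime P (X ^ (l * n) + 1) := by
    rw [X_pow_add_one_eq_prod hl hζ]
    refine IsCoprime.prod_right fun j hj => ?_
    have hj := Finset.mem_range.1 hj
    exact ((hirr j hj).coprime_iff_not_dvd.2 (hcon j hj)).symm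
  obtain ⟨a, b, hab⟩ := hcop
  have h := congrArg (AdjoinRoot.mk (X ^ (l * n) + 1)) hab
  rw [map_add, map_mul, map_mul, AdjoinRoot.mk_self, mul_zero, add_zero, map_one] at h
  exact IsUnit.of_mul_eq_one_right _ h

/-- The coefficients of the remainder modulo `X^n - r`. -/
theorem sum_mul_pow_eq_zero_of_dvd (hn : 0 < n) (r : ZMod q) (a : Fin (l * n) → ZMod q)
    (h : (X ^ n - C r) ∣ ∑ i : Fin (l * n), monomial (i : ℕ) (a i)) (i : Fin n) :
    ∑ k : Fin l, a (finProdFinEquiv (k, i)) * r ^ (k : ℕ) = 0 := by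
  set b : Fin n → ZMod q := fun i => ∑ k : Fin l, a (finProdFinEquiv (k, i)) * r ^ (k : ℕ)
  have hdiff : (X ^ n - C r) ∣ (∑ i : Fin (l * n), monomial (i : ℕ) (a i)) -
      ∑ i : Fin n, monomial (i : ℕ) (b i) := by
    -- The pair (k, i) stands for the exponent i + n k, and X^n - r divides X^(n k) - r^k.
    have h1 : (∑ i : Fin (l * n), monomial (i : ℕ) (a i)) - ∑ i : Fin n, monomial (i : ℕ) (b i) =
        ∑ i : Fin n, ∑ k : Fin l, C (a (finProdFinEquiv (k, i))) * X ^ (i : ℕ) *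
          ((X ^ n) ^ (k : ℕ) - C r ^ (k : ℕ)) := by
      rw [← finProdFinEquiv.sum_comp, Fintype.sum_prod_type_right, ← Finset.sum_sub_distrib]
      refine Finset.sum_congr rfl fun i _ => ?_
      rw [map_sum, ← Finset.sum_sub_distrib]
      refine Finset.sum_congr rfl fun k _ => ?_
      rw [← C_mul_X_pow_eq_monomial, ← C_mul_X_pow_eq_monomial, finProdFinEquiv_apply_val,
        pow_add, pow_mul, map_mul, map_pow]
      ring
    rw [h1]
    exact Finset.dvd_sum fun i _ => Finset.dvd_sum fun k _ =>
      Dvd.dvd.mul_left (sub_dvd_pow_sub_pow _ _ _) _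
  have hb : (X ^ n - C r) ∣ ∑ i : Fin n, monomial (i : ℕ) (b i) := by
    have := dvd_sub h hdiff
    rwa [sub_sub_cancel] at this
  have hzero := eq_zero_of_dvd_of_degree_lt hb (by
    rw [degree_X_pow_sub_C hn]
    exact sum_monomial_degree_lt b)
  have := sum_monomial_coeff_fin b i
  rw [hzero, Polynomial.coeff_zero] at this
  exact this.symm

end Factorization

/-! ### Fourier bound for linear combinations of ternary coefficients -/

section Fourier

variable {q l : ℕ}

theorem ternaryWeight_nonneg {p : ℝ} (h0 : 0 ≤ p) (h1 : p ≤ 1) (a : ZMod q) :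
    0 ≤ ternaryWeight p a := by
  unfold ternaryWeight
  split_ifs
  · exact h0
  · linarith
  · exact le_rfl

variable [Fact q.Prime]

/-- The characteristic function of a ternary coefficient. -/
def ternaryChar (p : ℝ) (y : ZMod q) : ℝ :=
  p + (1 - p) * Real.cos (2 * Real.pi * (y.val : ℝ) / q)

theorem sum_ternaryWeight_mul (hq : (1 : ZMod q) ≠ -1) (p : ℝ) (f : ZMod q → ℂ) :
    ∑ a : ZMod q, (ternaryWeight p a : ℂ) * f a =
      p * f 0 + ((1 - p) / 2 : ℝ) * (f 1 + f (-1)) := by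
  have h : ∀ a : ZMod q, (ternaryWeight p a : ℂ) * f a =
      (if a = 0 then (p : ℂ) * f a else 0) + ((if a = 1 then ((1 - p) / 2 : ℝ) * f a else 0) +
        (if a = -1 then ((1 - p) / 2 : ℝ) * f a else 0)) := by
    intro a
    unfold ternaryWeight
    by_cases h0 : a = 0
    · subst h0
      simp
    by_cases h1 : a = 1
    · subst h1
      simp [hq]
    by_cases h2 : a = -1
    · subst h2
      simp [hq.symm]
    simp [h0, h1, h2]
  simp_rw [h, Finset.sum_add_distrib, Finset.sum_ite_eq', Finset.mem_univ, if_true]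
  ring

theorem stdAddChar_add_neg (y : ZMod q) :
    ZMod.stdAddChar y + ZMod.stdAddChar (-y) =
      ((2 * Real.cos (2 * Real.pi * (y.val : ℝ) / q) : ℝ) : ℂ) := by
  have h1 := ZMod.stdAddChar_coe (N := q) (y.val : ℤ)
  have h2 := ZMod.stdAddChar_coe (N := q) (-(y.val : ℤ))
  rw [Int.cast_neg] at h2
  rw [Int.cast_natCast, ZMod.natCast_zmod_val] at h1 h2
  rw [h1, h2]
  push_cast
  rw [Complex.two_cos]
  congr 2 <;> ring

theorem sum_ternaryWeight_mul_stdAddChar (hq : (1 : ZMod q) ≠ -1) (p : ℝ) (y : ZMod q) :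
    ∑ a : ZMod q, (ternaryWeight p a : ℂ) * ZMod.stdAddChar (a * y) = ternaryChar p y := by
  rw [sum_ternaryWeight_mul hq p fun a => ZMod.stdAddChar (a * y), zero_mul, one_mul, neg_one_mul,
    stdAddChar_add_neg, AddChar.map_zero_eq_one, ternaryChar]
  push_cast
  ring

theorem ternaryChar_neg (p : ℝ) (y : ZMod q) : ternaryChar p (-y) = ternaryChar p y := by
  have h1 := stdAddChar_add_neg y
  have h2 := stdAddChar_add_neg (-y)
  rw [neg_neg, add_comm, h1, Complex.ofReal_inj] at h2
  unfold ternaryChar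
  linear_combination -(1 - p) / 2 * h2

theorem addChar_map_sum {A M ι : Type} [AddCommMonoid A] [CommMonoid M] (ψ : AddChar A M)
    (t : Finset ι) (f : ι → A) : ψ (∑ i ∈ t, f i) = ∏ i ∈ t, ψ (f i) := by
  classical
  induction t using Finset.induction_on with
  | empty => simp
  | insert i t hi ih => rw [Finset.sum_insert hi, Finset.prod_insert hi, AddChar.map_add_eq_mul, ih]

/-- The law of a linear combination of independent ternary coefficients, by Fourier inversion. -/
theorem sum_ternary_eq_fourier (hq : (1 : ZMod q) ≠ -1) (p : ℝ) (v : Fin l → ZMod q) (t : ZMod q) :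
    (q : ℂ) * ((∑ b : Fin l → ZMod q,
      if ∑ k, b k * v k = t then ∏ k, ternaryWeight p (b k) else 0 : ℝ) : ℂ) =
      ∑ j : ZMod q, ZMod.stdAddChar (j * -t) * ∏ k, (ternaryChar p (j * v k) : ℂ) := by
  have h1 : ∀ j : ZMod q, ∏ k, (ternaryChar p (j * v k) : ℂ) =
      ∑ b : Fin l → ZMod q, ∏ k, ((ternaryWeight p (b k) : ℂ) *
        ZMod.stdAddChar (b k * (j * v k))) := by
    intro j
    simp_rw [← sum_ternaryWeight_mul_stdAddChar hq]
    rw [Finset.prod_univ_sum, Fintype.piFinset_univ]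
  simp_rw [h1, Finset.mul_sum]
  rw [Finset.sum_comm, Complex.ofReal_sum, Finset.mul_sum]
  refine Finset.sum_congr rfl fun b _ => ?_
  have h2 : ∀ j : ZMod q, ZMod.stdAddChar (j * -t) *
      ∏ k, ((ternaryWeight p (b k) : ℂ) * ZMod.stdAddChar (b k * (j * v k))) =
      (∏ k, (ternaryWeight p (b k) : ℂ)) *
        ZMod.stdAddChar (j * (∑ k, b k * v k - t)) := by
    intro j
    rw [Finset.prod_mul_distrib, mul_left_comm, ← addChar_map_sum,
      ← AddChar.map_add_eq_mul]
    congr 2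
    rw [mul_sub, Finset.mul_sum, mul_neg, neg_add_eq_sub]
    congr 1
    refine Finset.sum_congr rfl fun k _ => ?_
    ring
  simp_rw [h2]
  -- Orthogonality of characters: the sum over j is q when the linear equation holds and 0
  -- otherwise.
  rw [← Finset.mul_sum, AddChar.sum_mulShift _ (ZMod.isPrimitive_stdAddChar q), ZMod.card]
  by_cases h : ∑ k, b k * v k = t
  · rw [if_pos h, if_pos (sub_eq_zero.2 h), mul_comm]
    push_cast
    rfl
  · rw [if_neg h, if_neg (sub_ne_zero.2 h)]
    simp

/-- Because ζ^l = -1 and the characteristic function is even, its value at j ζ^N depends only on N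
modulo l. Multiplication by e permutes the residues modulo l, so all the roots ζ^e give the same
product and one M serves every factor. -/
theorem prod_ternaryChar_perm {ζ : ZMod q} (hl : 0 < l) (hζ : ζ ^ l = -1) (p : ℝ) {e : ℕ}
    (he : e.Coprime l) (j : ZMod q) :
    ∏ k : Fin l, |ternaryChar p (j * (ζ ^ e) ^ (k : ℕ))| =
      ∏ k : Fin l, |ternaryChar p (j * ζ ^ (k : ℕ))| := by
  have hmod : ∀ N : ℕ, ternaryChar p (j * ζ ^ N) = ternaryChar p (j * ζ ^ (N % l)) := by
    intro N
    have h : ∀ a b : ℕ, ternaryChar p (j * ζ ^ (b + l * a)) = ternaryChar p (j * ζ ^ b) := by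
      intro a
      induction a with
      | zero => simp
      | succ a ih =>
        intro b
        rw [mul_add, mul_one, ← add_assoc, pow_add _ _ l, hζ, mul_neg_one, mul_neg,
          ternaryChar_neg, ih]
    rw [← h (N / l) (N % l), Nat.mod_add_div]
  let σ : Fin l → Fin l := fun k => ⟨e * k % l, Nat.mod_lt _ hl⟩
  have hσ : Function.Injective σ := by
    intro a b hab
    have h1 : e * a ≡ e * b [MOD l] := Fin.mk.inj_iff.1 hab
    have h2 := Nat.ModEq.cancel_left_of_coprime (he.symm : Nat.gcd l e = 1) h1
    exact Fin.ext (Nat.ModEq.eq_of_lt_of_lt h2 a.2 b.2)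
  rw [← (Finite.injective_iff_bijective.1 hσ).prod_comp
    fun k => |ternaryChar p (j * ζ ^ (k : ℕ))|]
  refine Finset.prod_congr rfl fun k _ => ?_
  rw [← pow_mul, hmod]

theorem maxProbBound_eq (p : ℝ) (ζ : ZMod q) :
    (q : ℝ) * maxProbBound q l p ζ =
      ∑ j : ZMod q, ∏ k : Fin l, |ternaryChar p (j * ζ ^ (k : ℕ))| := by
  have hq : (q : ℝ) ≠ 0 := by exact_mod_cast (Fact.out : q.Prime).ne_zero
  rw [← Finset.add_sum_erase _ _ (Finset.mem_univ (0 : ZMod q)), maxProbBound,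
    ← Finset.add_sum_erase _ _ (Finset.mem_univ (0 : ZMod q))]
  have h0 : ∏ k : Fin l, |ternaryChar p ((0 : ZMod q) * ζ ^ (k : ℕ))| = 1 := by
    simp [ternaryChar]
  rw [h0, if_pos rfl, zero_add, mul_add, mul_one_div_cancel hq, ← mul_assoc,
    mul_one_div_cancel hq, one_mul]
  congr 1
  refine Finset.sum_congr rfl fun j hj => ?_
  rw [if_neg (Finset.ne_of_mem_erase hj), Finset.prod_range]
  rfl

theorem maxProbBound_nonneg (p : ℝ) (ζ : ZMod q) : 0 ≤ maxProbBound q l p ζ := by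
  have hq : (0 : ℝ) < q := by exact_mod_cast (Fact.out : q.Prime).pos
  refine nonneg_of_mul_nonneg_right ?_ hq
  rw [maxProbBound_eq]
  exact Finset.sum_nonneg fun _ _ => Finset.prod_nonneg fun _ _ => abs_nonneg _

/-- Take absolute values in the Fourier inversion formula: the phase carrying t disappears, hence
the uniformity in t. -/
theorem sum_ternary_le_maxProbBound {ζ : ZMod q} (hl : 0 < l) (hζ : ζ ^ l = -1)
    (hq : (1 : ZMod q) ≠ -1) (p : ℝ) {e : ℕ} (he : e.Coprime l) (t : ZMod q) :
    (∑ b : Fin l → ZMod q,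
      if ∑ k, b k * (ζ ^ e) ^ (k : ℕ) = t then ∏ k, ternaryWeight p (b k) else 0) ≤
      maxProbBound q l p ζ := by
  have hq0 : (0 : ℝ) < q := by exact_mod_cast (Fact.out : q.Prime).pos
  refine le_of_mul_le_mul_left ?_ hq0
  rw [maxProbBound_eq]
  have h := congrArg norm (sum_ternary_eq_fourier hq p (fun k : Fin l => (ζ ^ e) ^ (k : ℕ)) t)
  rw [← Complex.ofReal_natCast, ← Complex.ofReal_mul, Complex.norm_real, Real.norm_eq_abs] at h
  refine (le_abs_self _).trans (h.le.trans ((norm_sum_le _ _).trans (le_of_eq ?_)))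
  refine Finset.sum_congr rfl fun j _ => ?_
  rw [← prod_ternaryChar_perm hl hζ p he, norm_mul, norm_prod, ZMod.stdAddChar_apply,
    Circle.norm_coe, one_mul]
  simp only [Complex.norm_real, Real.norm_eq_abs]

end Fourier

/-! ### The probability that a difference of ternary challenges is not invertible -/

section KnowledgeError

variable {q l n : ℕ} [Fact q.Prime]

/-- The independent blocks of coefficients. -/
theorem sum_ternary_blocks_le {ζ : ZMod q} (hl : 0 < l) (hζ : ζ ^ l = -1)
    (hq : (1 : ZMod q) ≠ -1) {p : ℝ} (h0 : 0 ≤ p) (h1 : p ≤ 1) {e : ℕ} (he : e.Coprime l)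
    (t : Fin n → ZMod q) :
    (∑ a : Fin (l * n) → ZMod q,
      if ∀ i, ∑ k : Fin l, a (finProdFinEquiv (k, i)) * (ζ ^ e) ^ (k : ℕ) = t i
        then ∏ i, ternaryWeight p (a i) else 0) ≤ maxProbBound q l p ζ ^ n := by
  -- Block i gathers the l coefficients whose index is congruent to i modulo n. Only these enter the
  -- i-th equation, so the sum factors over blocks.
  let E : (Fin n → Fin l → ZMod q) ≃ (Fin (l * n) → ZMod q) :=
    ((Equiv.curry _ _ _).symm.trans (Equiv.arrowCongr (Equiv.prodComm _ _) (Equiv.refl _))).trans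
      (Equiv.arrowCongr finProdFinEquiv (Equiv.refl _))
  have hE : ∀ b k i, E b (finProdFinEquiv (k, i)) = b i k := by
    intro b k i
    simp [E]
  rw [← E.sum_comp]
  have h : ∀ b : Fin n → Fin l → ZMod q,
      (if ∀ i, ∑ k : Fin l, E b (finProdFinEquiv (k, i)) * (ζ ^ e) ^ (k : ℕ) = t i
        then ∏ i, ternaryWeight p (E b i) else 0) =
      ∏ i, if ∑ k, b i k * (ζ ^ e) ^ (k : ℕ) = t i
        then ∏ k, ternaryWeight p (b i k) else 0 := by
    intro b
    simp only [hE]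
    rw [← finProdFinEquiv.prod_comp, Fintype.prod_prod_type_right]
    simp only [hE]
    by_cases hall : ∀ i, ∑ k : Fin l, b i k * (ζ ^ e) ^ (k : ℕ) = t i
    · rw [if_pos hall]
      exact Finset.prod_congr rfl fun i _ => (if_pos (hall i)).symm
    · rw [if_neg hall]
      push Not at hall
      obtain ⟨i, hi⟩ := hall
      exact (Finset.prod_eq_zero (Finset.mem_univ i) (if_neg hi)).symm
  simp_rw [h]
  rw [← Fintype.piFinset_univ, ← Finset.prod_univ_sum (fun _ => Finset.univ)
    fun i (b : Fin l → ZMod q) => if ∑ k, b k * (ζ ^ e) ^ (k : ℕ) = t i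
        then ∏ k, ternaryWeight p (b k) else 0]
  refine (Finset.prod_le_prod (fun i _ => ?_) fun i _ =>
    sum_ternary_le_maxProbBound hl hζ hq p he (t i)).trans (by simp)
  refine Finset.sum_nonneg fun b _ => ?_
  split_ifs
  · exact Finset.prod_nonneg fun k _ => ternaryWeight_nonneg h0 h1 _
  · exact le_rfl

/-- The cutoff on ‖c‖₁ destroys independence, but it only removes mass: drop it in the numerator and
keep the total mass P_ω as the denominator. -/
theorem expect_ternaryChallenge_le {d : ℕ} [NeZero d] {p : ℝ} (h0 : 0 ≤ p) (h1 : p ≤ 1) (ω : ℕ)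
    (h : ∑' c : Rq q d, ternaryMass p ω c ≠ 0) (S : Set (Fin d → ZMod q)) [DecidablePred (· ∈ S)] :
    expect (ternaryChallenge q d p ω h) ({c | coeff c ∈ S}.indicator 1) ≤
      ENNReal.ofReal (∑ a : Fin d → ZMod q, if a ∈ S then ∏ i, ternaryWeight p (a i) else 0) *
        (∑' c : Rq q d, ternaryMass p ω c)⁻¹ := by
  have hle : ∀ c, ternaryChallenge q d p ω h c * {c | coeff c ∈ S}.indicator 1 c ≤
      ENNReal.ofReal (if coeff c ∈ S then ∏ i, ternaryWeight p (coeff c i) else 0) *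
        (∑' c : Rq q d, ternaryMass p ω c)⁻¹ := by
    intro c
    by_cases hc : coeff c ∈ S
    · rw [Set.indicator_of_mem (by exact hc), Pi.one_apply, mul_one, if_pos hc, ternaryChallenge,
        PMF.normalize_apply]
      refine mul_le_mul' ?_ le_rfl
      rw [ENNReal.ofReal_prod_of_nonneg fun _ _ => ternaryWeight_nonneg h0 h1 _, ternaryMass]
      split_ifs
      · exact le_rfl
      · exact zero_le
    · rw [Set.indicator_of_notMem (by exact hc), mul_zero]
      exact zero_le
  refine (ENNReal.tsum_le_tsum hle).trans (le_of_eq ?_)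
  rw [ENNReal.tsum_mul_right, ← (coeffEquiv (ZMod q) d).tsum_eq, tsum_fintype,
    ENNReal.ofReal_sum_of_nonneg]
  · congr 1
    refine Finset.sum_congr rfl fun a _ => ?_
    have : coeff (coeffEquiv (ZMod q) d a) = a := (coeffEquiv (ZMod q) d).left_inv a
    rw [this]
  · intro a _
    split_ifs
    · exact Finset.prod_nonneg fun _ _ => ternaryWeight_nonneg h0 h1 _
    · exact le_rfl

theorem nonInvertibility_ternaryChallenge_le [NeZero (l * n)] {ζ : ZMod q} {p : ℝ} {ω : ℕ}
    (h : ∑' c : Rq q (l * n), ternaryMass p ω c ≠ 0) (hcop : ∀ j : ℕ, (2 * j + 1).Coprime l)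
    (hζ : IsPrimitiveRoot ζ (2 * l))
    (hirr : ∀ j < l, Irreducible (X ^ n - C (ζ ^ (2 * j + 1)) : (ZMod q)[X]))
    (h0 : 0 ≤ p) (h1 : p ≤ 1) :
    nonInvertibility (ternaryChallenge q (l * n) p ω h) ≤
      l * maxProbBound q l p ζ ^ n / (∑' c : Rq q (l * n), ternaryMass p ω c).toReal := by
  classical
  have hln := NeZero.ne (l * n)
  have hl : 0 < l := Nat.pos_of_ne_zero fun h => hln (by simp [h])
  have hn : 0 < n := Nat.pos_of_ne_zero fun h => hln (by simp [h])
  have hζl := pow_eq_neg_one_of_primitive hl hζ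
  -- A primitive 2l-th root excludes q = 2, so the weights at 1 and -1 are distinct points.
  have hq : (1 : ZMod q) ≠ -1 := fun h' =>
    hζ.pow_ne_one_of_pos_of_lt hl.ne' (by omega) (hζl.trans h'.symm)
  have hM := maxProbBound_nonneg (l := l) p ζ
  refine Real.iSup_le (fun c => ?_) (by positivity)
  rw [prob_eq_expect]
  -- The challenges with the same remainder as c modulo the j-th factor.
  let S : ℕ → Set (Fin (l * n) → ZMod q) := fun j => {a | ∀ i : Fin n,
    ∑ k : Fin l, a (finProdFinEquiv (k, i)) * (ζ ^ (2 * j + 1)) ^ (k : ℕ) =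
      ∑ k : Fin l, coeff c.1 (finProdFinEquiv (k, i)) * (ζ ^ (2 * j + 1)) ^ (k : ℕ)}
  have hunion : ∀ c' : Rq q (l * n), {c' | ¬ IsUnit (c.1 - c')}.indicator (1 : Rq q (l * n) → ℝ≥0∞) c' ≤
      ∑ j ∈ Finset.range l, {c' : Rq q (l * n) | coeff c' ∈ S j}.indicator 1 c' := by
    intro c'
    by_cases hc' : IsUnit (c.1 - c')
    · rw [Set.indicator_of_notMem (by simpa using hc')]
      exact zero_le
    obtain ⟨j, hj, hdvd⟩ := exists_dvd_of_not_isUnit hl hζ hirr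
      (∑ i : Fin (l * n), monomial (i : ℕ) (coeff (c.1 - c') i)) (by
        have := ofCoeffs_coeff (c.1 - c')
        rw [ofCoeffs] at this
        rwa [this])
    have hmem : coeff c' ∈ S j := by
      intro i
      have := sum_mul_pow_eq_zero_of_dvd hn _ _ hdvd i
      simp only [coeff_sub, sub_mul, Finset.sum_sub_distrib] at this
      exact (sub_eq_zero.1 this).symm
    refine (indicator_one_le_one _ _).trans ?_
    refine le_trans ?_ (Finset.single_le_sum (fun _ _ => zero_le) (Finset.mem_range.2 hj))
    rw [Set.indicator_of_mem (by exact hmem), Pi.one_apply]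
  have hbound : expect (ternaryChallenge q (l * n) p ω h)
      ({c' | ¬ IsUnit (c.1 - c')}.indicator 1) ≤
      l * (ENNReal.ofReal (maxProbBound q l p ζ ^ n) *
        (∑' c : Rq q (l * n), ternaryMass p ω c)⁻¹) := by
    refine (expect_mono _ hunion).trans ?_
    simp only [expect, Finset.mul_sum]
    rw [Summable.tsum_finsetSum fun _ _ => ENNReal.summable]
    refine (Finset.sum_le_sum fun j _ => (expect_ternaryChallenge_le h0 h1 ω h (S j)).trans
      (mul_le_mul' (ENNReal.ofReal_le_ofReal
        (sum_ternary_blocks_le hl hζl hq h0 h1 (hcop j) _)) le_rfl)).trans ?_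
    rw [Finset.sum_const, Finset.card_range, nsmul_eq_mul]
  have := ENNReal.toReal_mono (ENNReal.mul_ne_top (ENNReal.natCast_ne_top l)
    (ENNReal.mul_ne_top ENNReal.ofReal_ne_top (ENNReal.inv_ne_top.2 h))) hbound
  rw [ENNReal.toReal_mul, ENNReal.toReal_mul, ENNReal.toReal_ofReal (by positivity),
    ENNReal.toReal_inv, ENNReal.toReal_natCast, ← div_eq_mul_inv, ← mul_div_assoc] at this
  exact this

end KnowledgeError

end PoB

end

/-! ### Assembly of the theorem -/

theorem mainTheorem6 (κ lam : ℕ) (PT : Type) [Fintype PT] :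
    ∃ (Sim : PoB.Prog (κ + lam + 3) (PoB.TrVar κ (κ + lam + 3)) (PoB.InVar κ (κ + lam + 3) PT))
      (Ext : PoB.Prog (κ + lam + 3) (PoB.WitVar (κ + lam + 3)) (PoB.InVar κ (κ + lam + 3) PT)),
      -- running times of the simulator and of the extractor
      Sim.queries = 0 ∧
      Sim.steps ≤ 20 * (κ + 1) * (κ + lam + 3 + Fintype.card PT + 1) ∧
      Ext.queries = 2 ∧
      Ext.steps ≤ 20 * (κ + lam + 3) ∧
      ∀ (q d ω : ℕ) [Fact q.Prime] [NeZero d] (s : ℝ) (hs : 0 < s) (C : PMF (PoB.Rq q d)),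
        (∀ c ∈ C.support, PoB.l1 c ≤ ω) →
        ∀ x : PoB.Stmt q d κ (κ + lam + 3) PT,
        -- completeness and honest-verifier zero-knowledge
        (∀ (r : PT → Fin (κ + lam + 3) → PoB.RZ d) (msg : PT → Fin 3 → PoB.Rq q d),
          PoB.HonestInput s ω x r msg →
          (1 - (2 : ℝ)⁻¹ ^ 100) / 3 ≤
            PoB.prob (PoB.honestRun s hs C x (∑ i, r i)) {o | o.isSome} ∧
          1 - (2 : ℝ) ^ (-(((κ + lam + 3 : ℕ) * d : ℝ) / 8)) - (2 : ℝ)⁻¹ ^ 100 / 3 ≤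
            PoB.prob (PoB.honestRun s hs C x (∑ i, r i)) {o | ∃ t, o = some t ∧ PoB.Accepts s x t} /
              PoB.prob (PoB.honestRun s hs C x (∑ i, r i)) {o | o.isSome} ∧
          ∀ D : PoB.Transcript q d κ (κ + lam + 3) → PMF Bool,
            |PoB.prob ((PoB.honestRun s hs C x (∑ i, r i)).bind
                  fun o => o.elim (PMF.pure false) D) {true} /
                PoB.prob (PoB.honestRun s hs C x (∑ i, r i)) {o | o.isSome} -
              PoB.prob ((PoB.simulated Sim s hs C x).bind D) {true}| ≤ (2 : ℝ)⁻¹ ^ 100 / 3) ∧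
        -- two accepting transcripts give a weak opening with zero message, and any deviation from
        -- this opening gives a Module-SIS solution
        (∀ (w : Fin κ → PoB.Rq q d) (u c c' : PoB.Rq q d) (z z' : Fin (κ + lam + 3) → PoB.Rq q d),
          c ∈ C.support → c' ∈ C.support →
          PoB.Accepts s x ⟨w, u, c, z⟩ → PoB.Accepts s x ⟨w, u, c', z'⟩ →
          IsUnit (c - c') →
          (∑ i, (x.com i).com 2) - Ring.inverse (c - c') * (x.B ⬝ᵥ (z - z')) = 0 ∧
          PoB.BalanceRelation s ω x ⟨c - c', Ring.inverse (c - c') • (z - z'), 0⟩ ∧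
          (∀ c'' ∈ C.support, ∀ z'' : Fin (κ + lam + 3) → PoB.Rq q d,
            PoB.Accepts s x ⟨w, u, c'', z''⟩ →
            z'' - c'' • (Ring.inverse (c - c') • (z - z')) =
                z - c • (Ring.inverse (c - c') • (z - z')) ∨
              PoB.IsMSISSolution x.A (8 * ω * (s * √(2 * ((κ + lam + 3 : ℕ) * d))))
                ((c - c') • (z'' - z) - (c'' - c) • (z - z'))) ∧
          (∀ o : PoB.Opening q d (κ + lam + 3) 1, PoB.IsWeakOpening x.key03 x.sum03 s ω o →
            (o.r = Ring.inverse (c - c') • (z - z') ∧ o.msg = 0) ∨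
              PoB.IsMSISSolution x.A (8 * ω * (s * √(2 * ((κ + lam + 3 : ℕ) * d))))
                (o.cbar • (z - z') - (c - c') • (o.cbar • o.r)))) ∧
        -- knowledge soundness: the extractor succeeds against every prover
        (∀ P : PoB.Prover q d κ (κ + lam + 3),
          PoB.nonInvertibility C < P.acceptProb s C x →
          (P.acceptProb s C x - PoB.nonInvertibility C) ^ 2 ≤
            PoB.prob (PoB.extracted Ext s hs C x P) {o | PoB.BalanceRelation s ω x o}) ∧
        -- the knowledge error for ternary challenges
        (∀ (e l : ℕ) (p : ℝ) (ζ : ZMod q)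
          (h : ∑' c : PoB.Rq q d, PoB.ternaryMass p ω c ≠ 0),
          d = 2 ^ e → l ∣ d → IsPrimitiveRoot ζ (2 * l) →
          (∀ j < l, Irreducible
            (Polynomial.X ^ (d / l) - Polynomial.C (ζ ^ (2 * j + 1)) : Polynomial (ZMod q))) →
          0 ≤ p → p ≤ 1 → C = PoB.ternaryChallenge q d p ω h →
          PoB.nonInvertibility C ≤
            (q * PoB.maxProbBound q l p ζ) ^ (d / l) /
                (∑' c : PoB.Rq q d, PoB.ternaryMass p ω c).toReal *
              (l / (q : ℝ) ^ (d / l))) := by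
  refine ⟨PoB.simulator κ (κ + lam + 3) PT, PoB.extractor κ (κ + lam + 3) PT,
    PoB.simulator_queries _ _ _, PoB.simulator_steps _ _ _, PoB.extractor_queries _ _ _,
    PoB.extractor_steps _ _ _ (by omega), ?_⟩
  intro q d ω _ _ s hs C hC x
  have : NeZero q := ⟨(Fact.out : q.Prime).ne_zero⟩
  refine ⟨fun r msg h => ⟨?_, ?_, fun D => ?_⟩, ?_, fun P hP => PoB.knowledge_soundness hC P hP, ?_⟩
  · refine le_trans ?_ (PoB.prob_isSome_bounds h hC).2
    norm_num
  · have h1 := PoB.abs_conditional_sub_ideal_le (hs := hs) h hC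
      ({o | ∃ t, o = some t ∧ PoB.Accepts s x t}.indicator 1) (by simp)
      (PoB.indicator_one_le_one _)
    rw [← PoB.prob_eq_expect] at h1
    have h2 := PoB.one_sub_le_idealExpect_accepts (hs := hs) (C := C) (x := x)
    have h3 : (fun t : PoB.Transcript q d κ (κ + lam + 3) =>
        {o | ∃ t, o = some t ∧ PoB.Accepts s x t}.indicator
          (1 : Option (PoB.Transcript q d κ (κ + lam + 3)) → ENNReal) (some t)) =
        {t | PoB.Accepts s x t}.indicator 1 := by
      funext t
      by_cases ht : PoB.Accepts s x t <;> simp [ht]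
    rw [h3] at h1
    have h4 := (abs_le.1 h1).1
    linarith
  -- The test function is the probability that the distinguisher answers true; it is set to zero on
  -- aborts.
  · have h1 := PoB.abs_conditional_sub_ideal_le (hs := hs) h hC
      (fun o => (o.elim (PMF.pure false) D) true) (by simp) (fun o => PMF.coe_le_one _ _)
    rwa [PoB.prob_bind_true, PoB.prob_bind_true, PoB.expect_simulated]
  · intro w u c c' z z' hc hc' h h' hu
    exact ⟨PoB.com_sub_eq_zero h h' hu,
      PoB.balanceRelation_of_accepts (hC c hc) (hC c' hc') h h' hu,
      fun c'' hc'' z'' h'' =>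
        PoB.response_eq_or_isMSISSolution (hC c hc) (hC c' hc') h h' hu (hC c'' hc'') h'',
      fun o ho => PoB.opening_eq_or_isMSISSolution (hC c hc) (hC c' hc') h h' hu ho⟩
  · intro e l p ζ hmass hd hld hζ hirr hp0 hp1 hCeq
    obtain ⟨n, rfl⟩ := hld
    have hl : 0 < l := Nat.pos_of_ne_zero fun h => NeZero.ne (l * n) (by simp [h])
    -- As a divisor of 2^e, l is a power of two, hence coprime to every odd exponent 2j + 1.
    obtain ⟨i, -, hi⟩ := (Nat.dvd_prime_pow Nat.prime_two).1 (hd ▸ Dvd.intro n rfl : l ∣ 2 ^ e)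
    have hcop : ∀ j : ℕ, (2 * j + 1).Coprime l := fun j => by
      rw [hi]
      exact Nat.Coprime.pow_right _ (by simp)
    rw [Nat.mul_div_cancel_left n hl] at hirr ⊢
    rw [hCeq]
    refine (PoB.nonInvertibility_ternaryChallenge_le hmass hcop hζ hirr hp0 hp1).trans
      (le_of_eq ?_)
    have hq : (q : ℝ) ≠ 0 := NeZero.ne _
    rw [mul_pow]
    field_simp
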